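/- Let $N\ge 1$ be an integer, let $r>0$ be such that $1/r$ is a positive integer, and let $0<\sigma<1$. Consider the following fork–join queue with generalized-processor-sharing service (FJQ–GPS) in slotted time, slot $k=0,1,2,\dots$ being the interval $[k,k+1)$. Each of $N$ sensor nodes has an infinite first-in-first-out queue; at each sampling instant $t_b=b/r$, $b=1,2,\dots$, every node adds one packet to its queue, and these $N$ packets form batch $b$. Let $L_k^{(i)}$ be the length of the queue of node $i$ just after the beginning of slot $k$, and $N_k=\#\{i: L_k^{(i)}>0\}$. Given the past up to and including $L_k=(L_k^{(1)},\dots,L_k^{(N)})$, the index $M_k\in\{0,1,\dots,N\}$ of the node that transmits successfully in slot $k$ ($M_k=0$ meaning none) satisfies: $M_k=0$ if $N_k=0$; and if $N_k>0$, then $M_k=0$ with probability $1-\sigma$ and $M_k=j$ with probability $\sigma/N_k$ for each $j$ with $L_k^{(j)}>0$. A packet transmitted in slot $k$ is received at time $k+1$, so that $$L_{k+1}^{(i)}=L_k^{(i)}-\mathbf 1_{\{M_k=i\}}+\mathbf 1_{\{k+1\in\{t_1,t_2,\dots\}\}} .$$ Let $D_b=U_b-t_b$, where $U_b$ is the time at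 which all $N$ packets of batch $b$ have been received. Then there is a unique probability law on $\{0,1,2,\dots\}\cup\{\infty\}$, the law of the stationary batch delay $D$, such that, for every initial distribution of $L_0$ (in particular for $L_0=0$), $P(D_b\le n)\to P(D\le n)$ as $b\to\infty$ for every $n\in\{0,1,2,\dots\}$. The stationary delay $D$ is a proper random variable (that is, $P(D<\infty)=1$) with finite mean if and only if $Nr<\sigma$. -/

import Mathlib

open MeasureTheory ProbabilityTheory Filter Topology
open scoped NNReal ENNReal

noncomputable section

namespace FJQ

/-- State of the system in slot `k`: the queue lengths `L_k` just after the beginning of the slot,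
and the index `M_k` of the node that transmits successfully in the slot.  As an element of
`Fin (N + 1)`, `M_k = 0` means that there is no success, and `M_k = i.succ` that node `i`
succeeds. -/
abbrev State (N : ℕ) : Type := (Fin N → ℕ) × Fin (N + 1)

/-- The contending nodes: those with a nonempty queue. -/
def contending {N : ℕ} (L : Fin N → ℕ) : Finset (Fin N) :=
  Finset.univ.filter fun i => 0 < L i

open Classical in
/-- Law of `M_k` given `L_k = L`.  If some queue is nonempty, there is a success with probability
`σ`, and it is ascribed to one of the contending nodes, all with equal probability. -/
def serviceLaw {N : ℕ} (σ : ℝ≥0) (hσ : σ ≤ 1) (L : Fin N → ℕ) : PMF (Fin (N + 1)) :=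
  if h : (contending L).Nonempty then
    (PMF.bernoulli σ hσ).bind fun success =>
      if success then (PMF.uniformOfFinset (contending L) h).map Fin.succ else PMF.pure 0
  else PMF.pure 0

/-- The queue lengths in slot `k + 1`, given the state `s` in slot `k`: the packet transmitted in
slot `k` leaves at the end of this slot, and every node generates a packet at the time instant
`k + 1` if this is a sampling instant, that is, a multiple of the sampling period `m`. -/
def nextQueues {N : ℕ} (m k : ℕ) (s : State N) : Fin N → ℕ := fun i =>
  (s.1 i - if s.2 = i.succ then 1 else 0) + if m ∣ k + 1 then 1 else 0

/-- Law of the state in a slot whose queue lengths are `L`. -/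
def stateLaw {N : ℕ} (σ : ℝ≥0) (hσ : σ ≤ 1) (L : Fin N → ℕ) : PMF (State N) :=
  (serviceLaw σ hσ L).map fun M => (L, M)

/-- Transition kernel from the states in slots `0, …, k` to the state in slot `k + 1`. -/
def slotKernel (N m : ℕ) (σ : ℝ≥0) (hσ : σ ≤ 1) (k : ℕ) :
    Kernel (∀ _ : Finset.Iic k, State N) (State N) :=
  Kernel.ofFunOfCountable fun h =>
    (stateLaw σ hσ (nextQueues m k (h ⟨k, Finset.mem_Iic.2 le_rfl⟩))).toMeasure

instance (N m : ℕ) (σ : ℝ≥0) (hσ : σ ≤ 1) (k : ℕ) : IsMarkovKernel (slotKernel N m σ hσ k) :=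
  ⟨fun _ => PMF.toMeasure.isProbabilityMeasure _⟩

/-- Law of the sequence `(L_k, M_k)`, `k = 0, 1, 2, …`, when `L_0` has law `init`. -/
def pathLaw (N m : ℕ) (σ : ℝ≥0) (hσ : σ ≤ 1) (init : PMF (Fin N → ℕ)) :
    Measure (ℕ → State N) :=
  Kernel.trajMeasure (X := fun _ => State N) (init.bind (stateLaw σ hσ)).toMeasure
    (slotKernel N m σ hσ)

/-- Number of packets that node `i` transmits in the slots `0, …, k - 1`, that is, before the time
instant `k`. -/
def departures {N : ℕ} (ω : ℕ → State N) (i : Fin N) (k : ℕ) : ℕ :=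
  ((Finset.range k).filter fun j => (ω j).2 = i.succ).card

/-- The time instant at which the packet of node `i` belonging to batch `b` (`b = 1, 2, …`) has
been received.  Every queue is first-in-first-out, so this packet is number `L_0 i + b` among those
that node `i` transmits. -/
def receptionTime {N : ℕ} (ω : ℕ → State N) (i : Fin N) (b : ℕ) : ℕ∞ :=
  ⨅ (k : ℕ) (_ : (ω 0).1 i + b ≤ departures ω i k), (k : ℕ∞)

/-- The delay `D_b = max_i D_b^(i)` of batch `b`, which is sampled at the time instant `b * m`. -/
def batchDelay {N : ℕ} (m : ℕ) (ω : ℕ → State N) (b : ℕ) : ℕ∞ :=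
  ⨆ i, (receptionTime ω i b - ((b * m : ℕ) : ℕ∞))

/-- `ν` is the law of the stationary (steady-state) delay: whatever the law of the initial queue
lengths, the delay `D_b` of batch `b` converges in distribution to `ν` as `b → ∞`.  Delays take
values in `ℕ∞`, so that `ν` may charge `⊤`. -/
def IsStationaryDelayLaw (N m : ℕ) (σ : ℝ≥0) (hσ : σ ≤ 1) (ν : Measure ℕ∞) : Prop :=
  IsProbabilityMeasure ν ∧
    ∀ (init : PMF (Fin N → ℕ)) (n : ℕ),
      Tendsto (fun b => pathLaw N m σ hσ init {ω | batchDelay m ω b ≤ (n : ℕ∞)}) atTop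
        (𝓝 (ν (Set.Iic (n : ℕ∞))))

/-- A delay with law `ν` is finite almost surely. -/
def IsProper (ν : Measure ℕ∞) : Prop := ν {⊤} = 0

/-- A delay with law `ν` has finite mean. -/
def HasFiniteMean (ν : Measure ℕ∞) : Prop := ∫⁻ d, (d : ℝ≥0∞) ∂ν < ⊤

end FJQ

end

/-! Everything is expressed by `evol`, the inhomogeneous Markov evolution of the queue lengths,
which is `m`-periodic in the slot index (`m = 1 / r`). By conservation of packets, `D_b ≤ n` holds
exactly when no queue exceeds `n / m` in slot `b * m + n` (`batchDelay_le_iff`), so the delay is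
governed by the increasing functions `exceeds (n / m)`.

The evolution preserves the stochastic order (`serve_monotone`). Started empty, the system therefore
grows from period to period, and `P(D_b > n)` increases to a limit, `limitTail`. The total number of
packets is a Markov chain of its own (`serve_total`), with mean change `N - m * σ` over a period in
which it stays positive; its sign decides everything.

If `N < m * σ`, some `θ > 1` makes `θ ^ total` contract over a period. This makes the initial state
irrelevant (`evol_le_evol_zero_add`) and gives the limit an exponential tail
(`exists_limitTail_le`), hence a finite mean. If `N ≥ m * σ`, the total tends to infinity in
probability: by a Chernoff bound with `θ < 1` for `>`, and by comparing first and second moments for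
`=`. Then `limitTail` is identically `1` and all mass sits at `⊤`. Larger initial queues only
increase the tail, so the limit is the same for every initial law. -/

namespace FJQ

/-! ### The one-slot transition operator -/

section Operator

variable {N : ℕ}

/-- The queue lengths after a departure from node `j`. -/
def depart (j : Fin N) (L : Fin N → ℕ) : Fin N → ℕ := fun i => L i - if j = i then 1 else 0

/-- The queue lengths after the arrivals at the time instant `k + 1`. -/
def arrive (m k : ℕ) (L : Fin N → ℕ) : Fin N → ℕ := fun i => L i + if m ∣ k + 1 then 1 else 0

/-- Expectation of `g` at the queue lengths that the service in a slot leaves behind. -/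
noncomputable def serve (σ : ℝ) (g : (Fin N → ℕ) → ℝ) (L : Fin N → ℕ) : ℝ :=
  if (contending L).Nonempty then
    (1 - σ) * g L + σ * ((∑ j ∈ contending L, g (depart j L)) / (contending L).card)
  else g L

/-- Expectation of `g` at the queue lengths in slot `k + 1`, given those in slot `k`. -/
noncomputable def step (σ : ℝ) (m k : ℕ) (g : (Fin N → ℕ) → ℝ) : (Fin N → ℕ) → ℝ :=
  serve σ fun L => g (arrive m k L)

/-- Expectation of `g` at the queue lengths in slot `k + n`, given those in slot `k`. -/
noncomputable def evol (σ : ℝ) (m : ℕ) : ℕ → ℕ → ((Fin N → ℕ) → ℝ) → (Fin N → ℕ) → ℝ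
  | _, 0, g => g
  | k, n + 1, g => step σ m k (evol σ m (k + 1) n g)

/-- The total number of packets. -/
def total (L : Fin N → ℕ) : ℕ := ∑ i, L i

/-- The total number of packets after the arrivals at the time instant `k + 1`, if it is `t`
before. -/
def totalArrive (N m k t : ℕ) : ℕ := t + if m ∣ k + 1 then N else 0

lemma mem_contending {L : Fin N → ℕ} {j : Fin N} : j ∈ contending L ↔ 0 < L j := by
  simp [contending]

lemma contending_nonempty {L : Fin N → ℕ} : (contending L).Nonempty ↔ 0 < total L := by
  simp [Finset.Nonempty, mem_contending, total, Finset.sum_pos_iff]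

lemma depart_le (j : Fin N) (L : Fin N → ℕ) : depart j L ≤ L := fun _ => Nat.sub_le _ _

lemma depart_mono (j : Fin N) {L L' : Fin N → ℕ} (h : L ≤ L') : depart j L ≤ depart j L' :=
  fun i => Nat.sub_le_sub_right (h i) _

lemma arrive_mono (m k : ℕ) {L L' : Fin N → ℕ} (h : L ≤ L') : arrive m k L ≤ arrive m k L' :=
  fun i => Nat.add_le_add_right (h i) _

lemma total_mono {L L' : Fin N → ℕ} (h : L ≤ L') : total L ≤ total L' :=
  Finset.sum_le_sum fun i _ => h i

lemma total_depart {j : Fin N} {L : Fin N → ℕ} (h : 0 < L j) : total (depart j L) = total L - 1 := by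
  have : total (depart j L) + 1 = total L := by
    have h1 : (1 : ℕ) = ∑ i, if j = i then 1 else 0 := by simp
    unfold total depart
    conv_lhs => rw [h1]
    rw [← Finset.sum_add_distrib]
    refine Finset.sum_congr rfl fun i _ => ?_
    split_ifs with hi
    · subst hi; omega
    · rfl
  omega

lemma total_arrive (m k : ℕ) (L : Fin N → ℕ) :
    total (arrive m k L) = totalArrive N m k (total L) := by
  unfold total arrive totalArrive
  rw [Finset.sum_add_distrib]
  split_ifs <;> simp

lemma total_eq_zero {L : Fin N → ℕ} : total L = 0 ↔ L = 0 := by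
  simp [total, funext_iff]

lemma serve_mono {σ : ℝ} (h0 : 0 ≤ σ) (h1 : σ ≤ 1) {f g : (Fin N → ℕ) → ℝ} (h : f ≤ g) :
    serve σ f ≤ serve σ g := by
  intro L
  unfold serve
  split_ifs
  · have := sub_nonneg.2 h1
    gcongr
    · exact h _
    · exact h _
  · exact h _

lemma serve_const (σ c : ℝ) (L : Fin N → ℕ) : serve σ (fun _ => c) L = c := by
  unfold serve
  split_ifs with h
  · have : ((contending L).card : ℝ) ≠ 0 := by exact_mod_cast h.card_pos.ne'
    simp only [Finset.sum_const, nsmul_eq_mul]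
    field_simp
    ring
  · rfl

lemma serve_linear (σ a b : ℝ) (f g : (Fin N → ℕ) → ℝ) (L : Fin N → ℕ) :
    serve σ (fun x => a * f x + b * g x) L = a * serve σ f L + b * serve σ g L := by
  unfold serve
  split_ifs with h
  · simp only [Finset.sum_add_distrib, ← Finset.mul_sum]
    ring
  · rfl

/-- The transition probabilities of the total number of packets do not depend on its distribution
over the nodes. -/
lemma serve_total (σ : ℝ) (φ : ℕ → ℝ) (L : Fin N → ℕ) :
    serve σ (fun x => φ (total x)) L =
      if 0 < total L then (1 - σ) * φ (total L) + σ * φ (total L - 1) else φ (total L) := by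
  unfold serve
  simp only [contending_nonempty]
  split_ifs with h
  · have hc : ((contending L).card : ℝ) ≠ 0 := by
      exact_mod_cast (contending_nonempty.2 h).card_pos.ne'
    rw [Finset.sum_congr rfl fun j hj => by rw [total_depart (mem_contending.1 hj)]]
    simp only [Finset.sum_const, nsmul_eq_mul]
    field_simp
  · rfl

/-- The service preserves the stochastic order. -/
lemma serve_monotone {σ : ℝ} (h0 : 0 ≤ σ) (h1 : σ ≤ 1) {f : (Fin N → ℕ) → ℝ} (hf : Monotone f) :
    Monotone (serve σ f) := by
  intro L L' h
  have hs := sub_nonneg.2 h1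
  -- Nodes contending only in `L'` have an empty queue in `L`, so a departure from one of them
  -- leaves `L'` above `L`.
  have hC : contending L ⊆ contending L' := fun j hj =>
    mem_contending.2 ((mem_contending.1 hj).trans_le (h j))
  have hd : ∀ j ∈ contending L' \ contending L, f L ≤ f (depart j L') := by
    intro j hj
    rw [Finset.mem_sdiff, mem_contending, mem_contending] at hj
    refine hf fun i => ?_
    simp only [depart]
    split_ifs with hi
    · subst hi; exact (Nat.eq_zero_of_not_pos hj.2).le.trans (Nat.zero_le _)
    · exact h i
  unfold serve
  by_cases hL : (contending L).Nonempty
  · rw [if_pos hL, if_pos (hL.mono hC)]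
    have hc : (0 : ℝ) < (contending L).card := by exact_mod_cast hL.card_pos
    have hc' : (0 : ℝ) < (contending L').card := by exact_mod_cast (hL.mono hC).card_pos
    -- The average `a` over the smaller set is at most `f L`. Each additional node contributes at
    -- least `f L`, so enlarging the set of equally likely nodes cannot bring the average below `a`.
    have key : (∑ j ∈ contending L, f (depart j L)) / (contending L).card ≤
        (∑ j ∈ contending L', f (depart j L')) / (contending L').card := by
      set a := (∑ j ∈ contending L, f (depart j L)) / (contending L).card with ha
      have ha' : ∑ j ∈ contending L, f (depart j L) = (contending L).card * a := by
        rw [ha]; field_simp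
      have hale : a ≤ f L := by
        rw [ha, div_le_iff₀ hc, mul_comm, ← nsmul_eq_mul]
        exact Finset.sum_le_card_nsmul _ _ _ fun j _ => hf (depart_le j L)
      rw [le_div_iff₀ hc', ← Finset.sum_sdiff hC]
      have e1 : ∑ j ∈ contending L, f (depart j L) ≤ ∑ j ∈ contending L, f (depart j L') :=
        Finset.sum_le_sum fun j _ => hf (depart_mono j h)
      have e2 : ((contending L' \ contending L).card : ℝ) * a ≤
          ∑ j ∈ contending L' \ contending L, f (depart j L') := by
        rw [← nsmul_eq_mul]
        exact Finset.card_nsmul_le_sum _ _ _ fun j hj => hale.trans (hd j hj)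
      have e3 : ((contending L').card : ℝ) =
          (contending L' \ contending L).card + (contending L).card := by
        rw [← Finset.card_sdiff_add_card_eq_card hC]; push_cast; rfl
      rw [e3]
      linarith
    have := hf h
    gcongr
  · rw [if_neg hL]
    split_ifs with hL'
    · have hc' : (0 : ℝ) < (contending L').card := by exact_mod_cast hL'.card_pos
      have : f L ≤ (∑ j ∈ contending L', f (depart j L')) / (contending L').card := by
        rw [le_div_iff₀ hc', mul_comm, ← nsmul_eq_mul]
        refine Finset.card_nsmul_le_sum _ _ _ fun j hj => hd j ?_
        rw [Finset.not_nonempty_iff_eq_empty] at hL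
        simpa [hL] using hj
      nlinarith [hf h, mul_le_mul_of_nonneg_left this h0, mul_le_mul_of_nonneg_left (hf h) hs]
    · exact hf h

lemma step_mono {σ : ℝ} (h0 : 0 ≤ σ) (h1 : σ ≤ 1) (m k : ℕ) {f g : (Fin N → ℕ) → ℝ} (h : f ≤ g) :
    step σ m k f ≤ step σ m k g :=
  serve_mono h0 h1 fun _ => h _

lemma step_monotone {σ : ℝ} (h0 : 0 ≤ σ) (h1 : σ ≤ 1) (m k : ℕ) {f : (Fin N → ℕ) → ℝ}
    (hf : Monotone f) : Monotone (step σ m k f) :=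
  serve_monotone h0 h1 fun _ _ h => hf (arrive_mono m k h)

lemma step_total (σ : ℝ) (m k : ℕ) (φ : ℕ → ℝ) (L : Fin N → ℕ) :
    step σ m k (fun x => φ (total x)) L =
      if 0 < total L then
        (1 - σ) * φ (totalArrive N m k (total L)) + σ * φ (totalArrive N m k (total L - 1))
      else φ (totalArrive N m k (total L)) := by
  unfold step
  simp only [total_arrive]
  exact serve_total σ (fun t => φ (totalArrive N m k t)) L

lemma evol_mono {σ : ℝ} (h0 : 0 ≤ σ) (h1 : σ ≤ 1) (m k n : ℕ) {f g : (Fin N → ℕ) → ℝ}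
    (h : f ≤ g) : evol σ m k n f ≤ evol σ m k n g := by
  induction n generalizing k with
  | zero => exact h
  | succ n ih => exact step_mono h0 h1 m k (ih _)

lemma evol_monotone {σ : ℝ} (h0 : 0 ≤ σ) (h1 : σ ≤ 1) (m k n : ℕ) {f : (Fin N → ℕ) → ℝ}
    (hf : Monotone f) : Monotone (evol σ m k n f) := by
  induction n generalizing k with
  | zero => exact hf
  | succ n ih => exact step_monotone h0 h1 m k (ih _)

lemma evol_const (σ : ℝ) (m k n : ℕ) (c : ℝ) :
    evol σ m k n (fun _ : Fin N → ℕ => c) = fun _ => c := by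
  induction n generalizing k with
  | zero => rfl
  | succ n ih => funext L; simp only [evol, ih]; exact serve_const σ c L

lemma evol_linear (σ : ℝ) (m k n : ℕ) (a b : ℝ) (f g : (Fin N → ℕ) → ℝ) :
    evol σ m k n (fun x => a * f x + b * g x) =
      fun x => a * evol σ m k n f x + b * evol σ m k n g x := by
  induction n generalizing k with
  | zero => rfl
  | succ n ih => funext L; simp only [evol, ih]; exact serve_linear σ a b _ _ L

lemma evol_add (σ : ℝ) (m k n l : ℕ) (f : (Fin N → ℕ) → ℝ) :
    evol σ m k (n + l) f = evol σ m k n (evol σ m (k + n) l f) := by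
  induction n generalizing k with
  | zero => simp [evol]
  | succ n ih =>
    rw [add_right_comm, evol, ih, evol, add_right_comm k 1 n, add_assoc k n 1]

lemma evol_succ (σ : ℝ) (m k n : ℕ) (f : (Fin N → ℕ) → ℝ) :
    evol σ m k (n + 1) f = evol σ m k n (step σ m (k + n) f) :=
  evol_add σ m k n 1 f

lemma step_period (σ : ℝ) (m k : ℕ) (f : (Fin N → ℕ) → ℝ) :
    step σ m (k + m) f = step σ m k f := by
  have : m ∣ k + m + 1 ↔ m ∣ k + 1 := by
    rw [add_right_comm]; exact Nat.dvd_add_self_right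
  unfold step arrive
  simp only [this]

lemma evol_period (σ : ℝ) (m k n : ℕ) (f : (Fin N → ℕ) → ℝ) :
    evol σ m (k + m) n f = evol σ m k n f := by
  induction n generalizing k with
  | zero => rfl
  | succ n ih => rw [evol, evol, ← ih (k + 1), step_period, add_right_comm]

/-- For the system that starts empty, the queue lengths increase stochastically from one period to
the next. -/
lemma evol_zero_le_add_period {σ : ℝ} (h0 : 0 ≤ σ) (h1 : σ ≤ 1) (m n : ℕ) {f : (Fin N → ℕ) → ℝ}
    (hf : Monotone f) : evol σ m 0 n f 0 ≤ evol σ m 0 (n + m) f 0 := by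
  rw [add_comm, evol_add, evol_period]
  -- The first period is run on a constant function, as if the state were then reset to empty; the
  -- true state lies above `0`.
  calc evol σ m 0 n f 0 = evol σ m 0 m (fun _ => evol σ m 0 n f 0) 0 := by rw [evol_const]
    _ ≤ _ := evol_mono h0 h1 _ _ _ (fun x => evol_monotone h0 h1 _ _ _ hf (Pi.le_def.2 fun _ =>
        Nat.zero_le _)) 0

/-- A system that is empty in slot `k` is stochastically smaller later on than one that is empty in
slot `0`. -/
lemma evol_zero_le_evol_add {σ : ℝ} (h0 : 0 ≤ σ) (h1 : σ ≤ 1) (m k n : ℕ)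
    {f : (Fin N → ℕ) → ℝ} (hf : Monotone f) : evol σ m k n f 0 ≤ evol σ m 0 (k + n) f 0 := by
  rw [evol_add, zero_add]
  calc evol σ m k n f 0 = evol σ m 0 k (fun _ => evol σ m k n f 0) 0 := by rw [evol_const]
    _ ≤ _ := evol_mono h0 h1 _ _ _ (fun x => evol_monotone h0 h1 _ _ _ hf (Pi.le_def.2 fun _ =>
        Nat.zero_le _)) 0

end Operator

/-! ### Exponential and quadratic estimates for the total number of packets -/

section Estimates

variable {N : ℕ}

/-- While the system stays nonempty, each slot multiplies the mean of `θ ^ total` by `1 - σ + σ / θ`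
and each batch by `θ ^ N`. This is the factor for one period; it equals `1` at `θ = 1`, and its
slope there is the drift per period. -/
lemma hasDerivAt_periodFactor (N m : ℕ) (σ : ℝ) :
    HasDerivAt (fun θ : ℝ => θ ^ N * (1 - σ + σ / θ) ^ m) (N - m * σ) 1 := by
  have h1 : HasDerivAt (fun θ : ℝ => θ ^ N) (N : ℝ) 1 := by
    simpa using hasDerivAt_pow N (1 : ℝ)
  have h2 : HasDerivAt (fun θ : ℝ => 1 - σ + σ / θ) (-σ) 1 := by
    have := ((hasDerivAt_inv (one_ne_zero (α := ℝ))).const_mul σ).const_add (1 - σ)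
    simpa [div_eq_mul_inv] using this
  have h3 := h1.mul (h2.pow m)
  refine h3.congr_deriv ?_
  simp
  ring

/-- Below the critical load, some `θ > 1` makes `θ ^ total` decrease over a period on average, as
long as the system does not empty. -/
lemma exists_one_lt_periodFactor_lt_one {m : ℕ} {σ : ℝ} (h : (N : ℝ) < m * σ) :
    ∃ θ : ℝ, 1 < θ ∧ θ ^ N * (1 - σ + σ / θ) ^ m < 1 := by
  have hs := (hasDerivAt_iff_tendsto_slope.1 (hasDerivAt_periodFactor N m σ))
  have hev := (hs.mono_left (nhdsWithin_mono 1 fun x (hx : x ∈ Set.Ioi (1 : ℝ)) => hx.ne')).eventually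
    (gt_mem_nhds (sub_neg.2 h))
  obtain ⟨θ, hθ, hθ1⟩ := (hev.and self_mem_nhdsWithin).exists
  refine ⟨θ, hθ1, ?_⟩
  rw [slope_def_field, div_neg_iff] at hθ
  simp only [one_pow, div_one, sub_add_cancel, mul_one] at hθ
  rcases hθ with hθ | hθ <;> linarith

/-- Above the critical load, some `θ < 1` makes `θ ^ total` decrease over a period on average. -/
lemma exists_lt_one_periodFactor_lt_one {m : ℕ} {σ : ℝ} (h : m * σ < (N : ℝ)) :
    ∃ θ : ℝ, 0 < θ ∧ θ < 1 ∧ θ ^ N * (1 - σ + σ / θ) ^ m < 1 := by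
  have hs := (hasDerivAt_iff_tendsto_slope.1 (hasDerivAt_periodFactor N m σ))
  have hev := (hs.mono_left (nhdsWithin_mono 1 fun x (hx : x ∈ Set.Iio (1 : ℝ)) => hx.ne)).eventually
    (lt_mem_nhds (sub_pos.2 h))
  have hpos : ∀ᶠ θ : ℝ in 𝓝[<] 1, 0 < θ :=
    nhdsWithin_le_nhds (lt_mem_nhds (zero_lt_one (α := ℝ)))
  obtain ⟨θ, ⟨hθ, hθ0⟩, hθ1⟩ := ((hev.and hpos).and self_mem_nhdsWithin).exists
  refine ⟨θ, hθ0, hθ1, ?_⟩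
  rw [slope_def_field] at hθ
  rcases div_pos_iff.1 hθ with hθ | hθ <;>
    simp only [one_pow, div_one, sub_add_cancel, mul_one] at hθ <;> linarith

/-- The phase `k % m` rises by one per slot and drops by `m` at each sampling instant; this later
offsets the arrivals in the critical drift computation. -/
lemma succ_mod_add (m k : ℕ) : (k + 1) % m + (if m ∣ k + 1 then m else 0) = k % m + 1 := by
  have h1 := Nat.div_add_mod (k + 1) m
  have h2 := Nat.div_add_mod k m
  rw [Nat.succ_div, mul_add] at h1
  split_ifs at h1 ⊢ <;> omega

/-- The number of packets that arrive at the time instant `k + 1`. -/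
def arrivals (N m k : ℕ) : ℕ := if m ∣ k + 1 then N else 0

lemma arrivals_add_mul_div {m : ℕ} (k : ℕ) :
    arrivals N m k + N * (k / m) = N * ((k + 1) / m) := by
  rw [Nat.succ_div, arrivals]
  split_ifs <;> ring

lemma step_pow_total {σ θ : ℝ} (hθ : θ ≠ 0) (m k : ℕ) (L : Fin N → ℕ) :
    step σ m k (fun x => θ ^ total x) L =
      θ ^ arrivals N m k * if 0 < total L then (1 - σ + σ / θ) * θ ^ total L else 1 := by
  rw [step_total σ m k (fun t => θ ^ t)]
  simp only [totalArrive, arrivals, pow_add]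
  split_ifs with h h' h'
  all_goals try (rw [Nat.eq_zero_of_not_pos h]; ring)
  all_goals
    have e : θ ^ total L = θ * θ ^ (total L - 1) := by rw [← pow_succ']; congr 1; omega
    rw [e]
    field_simp

lemma step_linear (σ : ℝ) (m k : ℕ) (a b : ℝ) (f g : (Fin N → ℕ) → ℝ) (L : Fin N → ℕ) :
    step σ m k (fun x => a * f x + b * g x) L = a * step σ m k f L + b * step σ m k g L :=
  serve_linear σ a b _ _ L

lemma evol_nonneg {σ : ℝ} (h0 : 0 ≤ σ) (h1 : σ ≤ 1) (m k n : ℕ) {f : (Fin N → ℕ) → ℝ}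
    (hf : ∀ x, 0 ≤ f x) (L : Fin N → ℕ) : 0 ≤ evol σ m k n f L := by
  have := evol_mono h0 h1 m k n (f := fun _ => 0) (g := f) hf L
  rwa [evol_const] at this

lemma evol_mul_left (σ : ℝ) (m k n : ℕ) (a : ℝ) (f : (Fin N → ℕ) → ℝ) (L : Fin N → ℕ) :
    evol σ m k n (fun x => a * f x) L = a * evol σ m k n f L := by
  simpa using congrFun (evol_linear σ m k n a 0 f f) L

lemma evol_add_const (σ : ℝ) (m k n : ℕ) (a c : ℝ) (f : (Fin N → ℕ) → ℝ) (L : Fin N → ℕ) :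
    evol σ m k n (fun x => a * f x + c) L = a * evol σ m k n f L + c := by
  simpa [evol_const] using congrFun (evol_linear σ m k n a c f (fun _ => 1)) L

/-- The influence of the initial queue lengths decays exponentially, up to the arrivals. -/
lemma evol_le_evol_zero_add {σ θ : ℝ} (h0 : 0 ≤ σ) (h1 : σ ≤ 1) (hθ : 1 ≤ θ) (m k n : ℕ)
    {f : (Fin N → ℕ) → ℝ} (hf : Monotone f) (hf0 : ∀ x, 0 ≤ f x) (hf1 : ∀ x, f x ≤ 1)
    (L : Fin N → ℕ) :
    evol σ m k n f L ≤ evol σ m 0 (k + n) f 0 +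
      (1 - σ + σ / θ) ^ n * θ ^ (N * ((k + n) / m) - N * (k / m)) * θ ^ total L := by
  have hγ : 0 ≤ 1 - σ + σ / θ := add_nonneg (by linarith) (by positivity)
  induction n generalizing k L with
  | zero =>
    have := evol_nonneg h0 h1 m 0 (k + 0) hf0 0
    have h2 : 1 ≤ θ ^ total L := one_le_pow₀ hθ
    simp only [evol, pow_zero, add_zero, Nat.sub_self, one_mul] at *
    linarith [hf1 L]
  | succ n ih =>
    -- A nonempty system uses up one factor of the error term. An empty one is already dominated by
    -- the system empty since slot `0`, with no error.
    by_cases hL : 0 < total L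
    · set c := evol σ m 0 (k + 1 + n) f 0
      set w := (1 - σ + σ / θ) ^ n * θ ^ (N * ((k + 1 + n) / m) - N * ((k + 1) / m))
      have e1 : evol σ m k (n + 1) f L ≤
          step σ m k (fun x => c * (fun _ => (1 : ℝ)) x + w * θ ^ total x) L :=
        step_mono h0 h1 m k (fun x => by simpa using ih (k + 1) x) L
      rw [step_linear, step_pow_total (by positivity), if_pos hL,
        show step σ m k (fun _ => (1 : ℝ)) L = 1 from serve_const σ 1 L, mul_one] at e1
      refine e1.trans (le_of_eq ?_)
      have e2 : N * ((k + (n + 1)) / m) - N * (k / m) =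
          arrivals N m k + (N * ((k + 1 + n) / m) - N * ((k + 1) / m)) := by
        have a1 := arrivals_add_mul_div (N := N) (m := m) k
        have a2 : N * ((k + 1) / m) ≤ N * ((k + 1 + n) / m) :=
          Nat.mul_le_mul_left _ (Nat.div_le_div_right (by omega))
        rw [show k + (n + 1) = k + 1 + n by ring]
        omega
      rw [e2, show k + (n + 1) = k + 1 + n by ring, pow_add]
      simp only [c, w]
      ring
    · have hL0 : L = 0 := total_eq_zero.1 (by omega)
      subst hL0
      have := evol_zero_le_evol_add h0 h1 m k (n + 1) hf
      have : 0 ≤ (1 - σ + σ / θ) ^ (n + 1) *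
          θ ^ (N * ((k + (n + 1)) / m) - N * (k / m)) * θ ^ total (0 : Fin N → ℕ) := by positivity
      linarith

/-- Only complete periods are counted; the factors of the unfinished one are at most `1` and are
dropped. -/
lemma pow_mul_pow_div_le {γ θ : ℝ} (hγ : 0 ≤ γ) (hγ1 : γ ≤ 1) (hθ : 0 ≤ θ) (m n : ℕ) :
    γ ^ n * θ ^ (N * (n / m)) ≤ (θ ^ N * γ ^ m) ^ (n / m) := by
  rw [mul_pow, ← pow_mul, ← pow_mul, mul_comm]
  gcongr ?_ * ?_
  exact pow_le_pow_of_le_one hγ hγ1 (Nat.mul_div_le n m)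

/-- Below the critical load, exponential moments of the total number of packets are bounded in
time. -/
lemma exists_evol_pow_total_le {σ θ : ℝ} (h0 : 0 ≤ σ) (h1 : σ ≤ 1) (hθ : 1 ≤ θ) {m : ℕ}
    (hm : 1 ≤ m) (hρ : θ ^ N * (1 - σ + σ / θ) ^ m < 1) :
    ∃ C : ℝ, ∀ k, evol σ m 0 k (fun x : Fin N → ℕ => θ ^ total x) 0 ≤ C := by
  set γ := 1 - σ + σ / θ with hγdef
  have hγ : 0 ≤ γ := add_nonneg (by linarith) (by positivity)
  have hγ1 : γ ≤ 1 := by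
    have : σ / θ ≤ σ := div_le_self h0 hθ
    rw [hγdef]; linarith
  have hθN : 1 ≤ θ ^ N := one_le_pow₀ hθ
  -- The mean obeys `E (k + 1) ≤ θ ^ arrivals * (γ * E k + 1)`, the `1` covering the empty state.
  -- The induction bound `K * γ ^ phase + phase` closes over a period when `K` is at least the fixed
  -- point of `x ↦ θ ^ N * γ ^ m * x + θ ^ N * m`; adding `1` to it secures the start, where the
  -- mean is `1`.
  set K := θ ^ N * m / (1 - θ ^ N * γ ^ m) + 1 with hK
  have hK0 : 1 ≤ K := by
    have : 0 ≤ θ ^ N * m / (1 - θ ^ N * γ ^ m) :=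
      div_nonneg (by positivity) (by linarith)
    linarith
  have hKstep : θ ^ N * γ ^ m * K + θ ^ N * m ≤ K := by
    have : (1 - θ ^ N * γ ^ m) * (K - 1) = θ ^ N * m := by
      rw [hK]; field_simp [(sub_pos.2 hρ).ne']; ring
    nlinarith
  have key : ∀ k, evol σ m 0 k (fun x : Fin N → ℕ => θ ^ total x) 0 ≤
      K * γ ^ (k % m) + (k % m : ℕ) := by
    intro k
    induction k with
    | zero => simpa [evol, total] using hK0
    | succ k ih =>
      have e1 : evol σ m 0 (k + 1) (fun x : Fin N → ℕ => θ ^ total x) 0 ≤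
          θ ^ arrivals N m k * (γ * (K * γ ^ (k % m) + (k % m : ℕ)) + 1) := by
        rw [evol_succ, zero_add]
        calc _ ≤ evol σ m 0 k (fun x : Fin N → ℕ =>
                (θ ^ arrivals N m k * γ) * θ ^ total x + θ ^ arrivals N m k) 0 := by
              refine evol_mono h0 h1 _ _ _ (fun L => ?_) 0
              have hpos : 0 ≤ θ ^ arrivals N m k := by positivity
              have h3 : 0 ≤ θ ^ arrivals N m k * γ * θ ^ total L := by positivity
              simp only []
              rw [step_pow_total (by positivity)]
              split_ifs <;> linarith
          _ = θ ^ arrivals N m k *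
                (γ * evol σ m 0 k (fun x : Fin N → ℕ => θ ^ total x) 0 + 1) := by
              rw [evol_add_const]; ring
          _ ≤ _ := by gcongr
      refine e1.trans ?_
      by_cases hd : m ∣ k + 1
      · have hk : k % m + 1 = m := by
          have := succ_mod_add m k
          rw [Nat.mod_eq_zero_of_dvd hd, if_pos hd] at this
          omega
        rw [Nat.mod_eq_zero_of_dvd hd, arrivals, if_pos hd]
        have e2 : γ * (K * γ ^ (k % m)) = K * γ ^ m := by
          rw [← hk, pow_succ, hk]; ring
        have e3 : γ * (k % m : ℕ) + 1 ≤ (m : ℝ) := by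
          have : ((k % m : ℕ) : ℝ) + 1 = m := by exact_mod_cast hk
          have : γ * (k % m : ℕ) ≤ (k % m : ℕ) := mul_le_of_le_one_left (by positivity) hγ1
          linarith
        simp only [pow_zero, mul_one, Nat.cast_zero, add_zero]
        calc _ = θ ^ N * (K * γ ^ m + (γ * (k % m : ℕ) + 1)) := by rw [← e2]; ring
          _ ≤ θ ^ N * (K * γ ^ m + m) := by gcongr
          _ = θ ^ N * γ ^ m * K + θ ^ N * m := by ring
          _ ≤ K := hKstep
      · have hk : (k + 1) % m = k % m + 1 := by
          simpa [hd] using succ_mod_add m k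
        rw [hk, arrivals, if_neg hd, pow_zero, one_mul]
        have : γ * (k % m : ℕ) ≤ (k % m : ℕ) := mul_le_of_le_one_left (by positivity) hγ1
        push_cast
        rw [pow_succ]
        nlinarith
  refine ⟨K + m, fun k => (key k).trans ?_⟩
  have : γ ^ (k % m) ≤ 1 := pow_le_one₀ hγ hγ1
  have : ((k % m : ℕ) : ℝ) ≤ m := by exact_mod_cast (Nat.mod_lt k hm).le
  nlinarith

/-- For `θ ≤ 1` the slot factor is at least `1`, so it also bounds slots in which the system is
empty and no correction is needed. -/
lemma evol_pow_total_le {σ θ : ℝ} (h0 : 0 ≤ σ) (h1 : σ ≤ 1) (hθ0 : 0 < θ) (hθ : θ ≤ 1)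
    (m n : ℕ) : evol σ m 0 n (fun x : Fin N → ℕ => θ ^ total x) 0 ≤
      (1 - σ + σ / θ) ^ n * θ ^ (N * (n / m)) := by
  set γ := 1 - σ + σ / θ with hγdef
  have hγ : 1 ≤ γ := by
    have : σ ≤ σ / θ := le_div_self h0 hθ0 hθ
    rw [hγdef]; linarith
  induction n with
  | zero => simp [evol, total]
  | succ k ih =>
    rw [evol_succ, zero_add]
    calc _ ≤ evol σ m 0 k (fun x : Fin N → ℕ => (θ ^ arrivals N m k * γ) * θ ^ total x) 0 := by
          refine evol_mono h0 h1 _ _ _ (fun L => ?_) 0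
          simp only []
          rw [step_pow_total hθ0.ne', mul_assoc]
          gcongr
          split_ifs with h
          · exact le_rfl
          · simpa [Nat.eq_zero_of_not_pos h] using hγ
      _ ≤ (θ ^ arrivals N m k * γ) * (γ ^ k * θ ^ (N * (k / m))) := by
          rw [evol_mul_left]; gcongr
      _ = _ := by
          rw [← arrivals_add_mul_div, pow_add, pow_succ]; ring

end Estimates

/-! ### Instability at and above the critical load -/

section Unstable

variable {N : ℕ}

/-- The probability that at most `c` packets are in the system in slot `k`, when it is empty in
slot `0`. -/
noncomputable def totalCdf (N : ℕ) (σ : ℝ) (m k c : ℕ) : ℝ :=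
  evol σ m 0 k (fun x : Fin N → ℕ => if total x ≤ c then 1 else 0) 0

lemma totalCdf_nonneg {σ : ℝ} (h0 : 0 ≤ σ) (h1 : σ ≤ 1) (m k c : ℕ) : 0 ≤ totalCdf N σ m k c :=
  evol_nonneg h0 h1 _ _ _ (fun x => by split_ifs <;> norm_num) _

lemma totalCdf_add_period_le {σ : ℝ} (h0 : 0 ≤ σ) (h1 : σ ≤ 1) (m k c : ℕ) :
    totalCdf N σ m (k + m) c ≤ totalCdf N σ m k c := by
  have e : (fun x : Fin N → ℕ => if total x ≤ c then (1 : ℝ) else 0) =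
      fun x => -1 * (if total x ≤ c then 0 else 1) + 1 := by
    funext x; split_ifs <;> norm_num
  have := evol_zero_le_add_period h0 h1 m k
    (f := fun x : Fin N → ℕ => if total x ≤ c then (0 : ℝ) else 1) (fun x y hxy => by
      have := total_mono hxy
      dsimp only
      split_ifs <;> first | omega | norm_num)
  rw [totalCdf, totalCdf, e, evol_add_const, evol_add_const]
  linarith

/-- At most one packet leaves per slot. -/
lemma totalCdf_succ_le {σ : ℝ} (h0 : 0 ≤ σ) (h1 : σ ≤ 1) (m k c : ℕ) :
    totalCdf N σ m (k + 1) c ≤ totalCdf N σ m k (c + 1) := by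
  rw [totalCdf, evol_succ]
  refine evol_mono h0 h1 _ _ _ (fun L => ?_) 0
  rw [step_total σ m _ (fun t => if t ≤ c then 1 else 0)]
  simp only [totalArrive]
  split_ifs <;> first | omega | linarith

lemma totalCdf_add_le {σ : ℝ} (h0 : 0 ≤ σ) (h1 : σ ≤ 1) (m k n c : ℕ) :
    totalCdf N σ m (k + n) c ≤ totalCdf N σ m k (c + n) := by
  induction n generalizing c with
  | zero => exact le_rfl
  | succ n ih =>
    rw [← add_assoc]
    exact (totalCdf_succ_le h0 h1 m _ c).trans ((ih (c + 1)).trans_eq (by congr 1; ring))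

/-- A success has probability `σ`. With truncated subtraction, `c - 1` also serves the empty system,
where nothing leaves. -/
lemma mul_totalCdf_le {σ : ℝ} (h0 : 0 ≤ σ) (h1 : σ ≤ 1) (m k c : ℕ) :
    σ * totalCdf N σ m k c ≤ totalCdf N σ m (k + 1) (totalArrive N m k (c - 1)) := by
  rw [totalCdf, totalCdf, evol_succ, ← evol_mul_left]
  refine evol_mono h0 h1 _ _ _ (fun L => ?_) 0
  rw [step_total σ m _ (fun t => if t ≤ totalArrive N m k (c - 1) then 1 else 0)]
  simp only [totalArrive, zero_add, add_le_add_iff_right]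
  split_ifs <;> first | omega | linarith

lemma pow_mul_totalCdf_le {σ : ℝ} (h0 : 0 ≤ σ) (h1 : σ ≤ 1) (m b j c : ℕ) (hj : j < m) :
    σ ^ j * totalCdf N σ m (b * m) c ≤ totalCdf N σ m (b * m + j) (c - j) := by
  induction j with
  | zero => simp
  | succ j ih =>
    have h2 := mul_totalCdf_le (N := N) h0 h1 m (b * m + j) (c - j)
    have hd : ¬ m ∣ b * m + j + 1 := by
      rw [add_assoc, Nat.dvd_add_right (Dvd.intro_left b rfl)]
      exact Nat.not_dvd_of_pos_of_lt (by omega) hj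
    rw [totalArrive, if_neg hd, add_zero, Nat.sub_sub] at h2
    calc _ = σ * (σ ^ j * totalCdf N σ m (b * m) c) := by ring
      _ ≤ σ * totalCdf N σ m (b * m + j) (c - j) := by gcongr; exact ih (by omega)
      _ ≤ _ := h2

/-- A full period of successes has probability at least `σ ^ m`; it removes up to `m` packets before
`N` new ones arrive. -/
lemma pow_period_mul_totalCdf_le {σ : ℝ} (h0 : 0 ≤ σ) (h1 : σ ≤ 1) {m : ℕ} (hm : 1 ≤ m)
    (b c : ℕ) :
    σ ^ m * totalCdf N σ m (b * m) c ≤ totalCdf N σ m ((b + 1) * m) (c - m + N) := by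
  obtain ⟨j, rfl⟩ : ∃ j, m = j + 1 := ⟨m - 1, by omega⟩
  have h2 := mul_totalCdf_le (N := N) h0 h1 (j + 1) (b * (j + 1) + j) (c - j)
  have hd : (j + 1) ∣ b * (j + 1) + j + 1 := ⟨b + 1, by ring⟩
  rw [totalArrive, if_pos hd, Nat.sub_sub] at h2
  calc _ = σ * (σ ^ j * totalCdf N σ (j + 1) (b * (j + 1)) c) := by ring
    _ ≤ σ * totalCdf N σ (j + 1) (b * (j + 1) + j) (c - j) := by
        gcongr; exact pow_mul_totalCdf_le h0 h1 _ b j c (by omega)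
    _ ≤ _ := h2
    _ = _ := by congr 1; ring

/-! ### Moment comparison at the critical load -/

lemma sq_evol_le {σ : ℝ} (h0 : 0 ≤ σ) (h1 : σ ≤ 1) (m k n : ℕ) (f : (Fin N → ℕ) → ℝ)
    (L : Fin N → ℕ) : (evol σ m k n f L) ^ 2 ≤ evol σ m k n (fun x => f x ^ 2) L := by
  set c := evol σ m k n f L with hc
  have e1 := evol_nonneg h0 h1 m k n (f := fun x => (f x - c) ^ 2) (fun x => sq_nonneg _) L
  have e2 : (fun x => (f x - c) ^ 2) =
      fun x => 1 * (fun x => f x ^ 2) x + (-2 * c) * (fun x => f x + -c / 2) x := by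
    funext x; ring
  have e3 : evol σ m k n (fun x => f x + -c / 2) L = c + -c / 2 := by
    simpa [← hc] using evol_add_const σ m k n 1 (-c / 2) f L
  rw [e2, evol_linear] at e1
  simp only [e3] at e1
  nlinarith

/-- When `N = m * σ`, the fall of `σ * phase` at a sampling instant cancels the arrivals exactly. So
`total + σ * phase` gains `σ` per slot and loses `1` per departure, with mean change zero while
nonempty. -/
lemma totalArrive_add {σ : ℝ} {m : ℕ} (h : (N : ℝ) = m * σ) (k t : ℕ) :
    (totalArrive N m k t : ℝ) + σ * ((k + 1) % m : ℕ) = t + σ * (k % m : ℕ) + σ := by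
  have hmod : (((k + 1) % m : ℕ) : ℝ) + (if m ∣ k + 1 then (m : ℝ) else 0) = (k % m : ℕ) + 1 := by
    have := succ_mod_add m k
    split_ifs at this ⊢ <;> exact_mod_cast this
  unfold totalArrive
  split_ifs at hmod ⊢
  · push_cast
    linear_combination σ * hmod + h
  · push_cast
    linear_combination σ * hmod

/-- At the critical load, the total number of packets plus `σ` times the age of the period grows
on average only by `σ` for every slot in which the system is empty. -/
lemma evol_total_add_eq {σ : ℝ} {m : ℕ} (h : (N : ℝ) = m * σ) (k : ℕ) :
    evol σ m 0 k (fun x : Fin N → ℕ => (total x : ℝ) + σ * (k % m : ℕ)) 0 =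
      σ * ∑ j ∈ Finset.range k, totalCdf N σ m j 0 := by
  induction k with
  | zero => simp [evol, total]
  | succ k ih =>
    have e : step σ m (0 + k) (fun x : Fin N → ℕ => (total x : ℝ) + σ * ((k + 1) % m : ℕ)) =
        fun x => 1 * (fun x => (total x : ℝ) + σ * (k % m : ℕ)) x +
          σ * (fun x => if total x ≤ 0 then 1 else 0) x := by
      funext L
      rw [zero_add, step_total σ m k (fun t => (t : ℝ) + σ * ((k + 1) % m : ℕ))]
      simp only [totalArrive_add h]
      by_cases hL : 0 < total L
      · simp only [if_pos hL, if_neg (not_le.2 hL), Nat.cast_sub (Nat.one_le_iff_ne_zero.2 hL.ne')]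
        push_cast
        ring
      · simp only [if_neg hL, if_pos (not_lt.1 hL)]
        ring
    rw [evol_succ, e, evol_linear, Finset.sum_range_succ]
    simp only [ih, totalCdf]
    ring

/-- In a nonempty slot the second moment grows by the variance `σ * (1 - σ)`. In an empty slot the
process is only `σ * phase`, so the cross term stays below `2 * m`. -/
lemma evol_sq_total_add_le {σ : ℝ} (h0 : 0 ≤ σ) (h1 : σ ≤ 1) {m : ℕ} (hm : 1 ≤ m)
    (h : (N : ℝ) = m * σ) (k : ℕ) :
    evol σ m 0 k (fun x : Fin N → ℕ => ((total x : ℝ) + σ * (k % m : ℕ)) ^ 2) 0 ≤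
      (2 * m + 1) * k := by
  induction k with
  | zero => simp [evol, total]
  | succ k ih =>
    have e : step σ m (0 + k)
        (fun x : Fin N → ℕ => ((total x : ℝ) + σ * ((k + 1) % m : ℕ)) ^ 2) ≤
        fun x => 1 * (fun x => ((total x : ℝ) + σ * (k % m : ℕ)) ^ 2) x + (2 * m + 1) := by
      intro L
      rw [zero_add, step_total σ m k (fun t => ((t : ℝ) + σ * ((k + 1) % m : ℕ)) ^ 2)]
      simp only [totalArrive_add h]
      by_cases hL : 0 < total L
      · simp only [if_pos hL, Nat.cast_sub (Nat.one_le_iff_ne_zero.2 hL.ne')]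
        push_cast
        nlinarith [mul_nonneg h0 (sub_nonneg.2 h1), (Nat.cast_nonneg m : (0 : ℝ) ≤ m)]
      · simp only [Nat.eq_zero_of_not_pos hL, lt_irrefl, if_false, Nat.cast_zero, zero_add]
        have hk : ((k % m : ℕ) : ℝ) ≤ m := by exact_mod_cast (Nat.mod_lt k hm).le
        have hk0 : (0 : ℝ) ≤ (k % m : ℕ) := Nat.cast_nonneg _
        have hσ2 : σ ^ 2 ≤ 1 := pow_le_one₀ h0 h1
        nlinarith [mul_le_mul hσ2 hk hk0 zero_le_one]
    rw [evol_succ]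
    refine (evol_mono h0 h1 _ _ _ e 0).trans ?_
    rw [evol_add_const]
    push_cast
    linarith

/-- At the critical load, the probability to find the system empty at the end of a period tends
to `0`. -/
lemma tendsto_totalCdf_zero {σ : ℝ} (h0 : 0 < σ) (h1 : σ ≤ 1) {m : ℕ} (hm : 1 ≤ m)
    (h : (N : ℝ) = m * σ) :
    Tendsto (fun b => totalCdf N σ m (b * m + (m - 1)) 0) atTop (𝓝 0) := by
  have hnn := fun k => totalCdf_nonneg (N := N) h0.le h1 m k 0
  have hanti : Antitone fun b => totalCdf N σ m (b * m + (m - 1)) 0 := by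
    refine antitone_nat_of_succ_le fun b => ?_
    have := totalCdf_add_period_le (N := N) h0.le h1 m (b * m + (m - 1)) 0
    rwa [show b * m + (m - 1) + m = (b + 1) * m + (m - 1) by ring] at this
  -- The probabilities of emptiness at the ends of periods decrease, so `b` times the latest one is
  -- below the expected number of empty slots.
  have hsum : ∀ b : ℕ, (b : ℝ) * totalCdf N σ m (b * m + (m - 1)) 0 ≤
      ∑ j ∈ Finset.range (b * m), totalCdf N σ m j 0 := by
    intro b
    calc (b : ℝ) * totalCdf N σ m (b * m + (m - 1)) 0
        = ∑ i ∈ Finset.range b, totalCdf N σ m (b * m + (m - 1)) 0 := by simp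
      _ ≤ ∑ i ∈ Finset.range b, totalCdf N σ m (i * m + (m - 1)) 0 :=
          Finset.sum_le_sum fun i hi => hanti (Finset.mem_range.1 hi).le
      _ = ∑ j ∈ (Finset.range b).image (fun i => i * m + (m - 1)), totalCdf N σ m j 0 := by
          rw [Finset.sum_image]
          intro i _ j _ hij
          exact Nat.eq_of_mul_eq_mul_right hm (Nat.add_right_cancel hij)
      _ ≤ _ := by
          refine Finset.sum_le_sum_of_subset_of_nonneg ?_ fun j _ _ => hnn j
          intro j hj
          obtain ⟨i, hi, rfl⟩ := Finset.mem_image.1 hj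
          rw [Finset.mem_range] at hi ⊢
          calc i * m + (m - 1) < (i + 1) * m := by rw [add_mul]; omega
            _ ≤ b * m := Nat.mul_le_mul_right _ hi
  -- The first moment is `σ` times the expected number of empty slots, and its square is at most the
  -- second moment, which is linear in time. Hence the probability is `O(b ^ (-1/2))`.
  have hsq : ∀ b : ℕ, totalCdf N σ m ((b + 1) * m + (m - 1)) 0 ^ 2 ≤
      ((2 * m + 1) * m / σ ^ 2) * (1 / ((b : ℝ) + 1)) := by
    intro b
    have e1 := sq_evol_le h0.le h1 m 0 ((b + 1) * m)
      (fun x : Fin N → ℕ => (total x : ℝ) + σ * ((b + 1) * m % m : ℕ)) 0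
    rw [evol_total_add_eq h] at e1
    have e2 := e1.trans (evol_sq_total_add_le h0.le h1 hm h ((b + 1) * m))
    have e3 := hsum (b + 1)
    have e4 := pow_le_pow_left₀ (mul_nonneg (Nat.cast_nonneg _) (hnn _)) e3 2
    have hb : (0 : ℝ) < b + 1 := by positivity
    rw [div_mul_div_comm, mul_one, le_div_iff₀ (by positivity)]
    push_cast at e2 e4
    have e5 := mul_le_mul_of_nonneg_left e4 (sq_nonneg σ)
    have e6 : ((b : ℝ) + 1) * (totalCdf N σ m ((b + 1) * m + (m - 1)) 0 ^ 2 *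
        (σ ^ 2 * ((b : ℝ) + 1))) ≤ ((b : ℝ) + 1) * ((2 * m + 1) * m) := by nlinarith
    exact le_of_mul_le_mul_left e6 hb
  have hlim : Tendsto (fun b => totalCdf N σ m ((b + 1) * m + (m - 1)) 0 ^ 2) atTop (𝓝 0) := by
    refine squeeze_zero (fun b => sq_nonneg _) hsq ?_
    simpa using (tendsto_one_div_add_atTop_nhds_zero_nat (𝕜 := ℝ)).const_mul
      ((2 * m + 1) * m / σ ^ 2)
  have hlim2 := hlim.sqrt
  simp only [Real.sqrt_sq (hnn _), Real.sqrt_zero] at hlim2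
  exact (tendsto_add_atTop_iff_nat (f := fun b => totalCdf N σ m (b * m + (m - 1)) 0) 1).1 hlim2

/-- For `c < m`, `m - 1` successes would empty the system by the end of the period, which is
asymptotically impossible. For larger `c`, a period of successes lowers the level to `c - m + N`;
this is less than `c` because `σ < 1` forces `N < m`. -/
lemma tendsto_totalCdf_of_eq {σ : ℝ} (h0 : 0 < σ) (h1 : σ < 1) {m : ℕ} (hm : 1 ≤ m)
    (h : (N : ℝ) = m * σ) (c : ℕ) :
    Tendsto (fun b => totalCdf N σ m (b * m) c) atTop (𝓝 0) := by
  have hmR : (0 : ℝ) < m := by exact_mod_cast hm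
  have hNm : N < m := by
    have : (N : ℝ) < m := by rw [h]; exact mul_lt_of_lt_one_right hmR h1
    exact_mod_cast this
  induction c using Nat.strong_induction_on with
  | _ c ih =>
    by_cases hc : c < m
    · have e : ∀ b, totalCdf N σ m (b * m) c ≤
          (σ ^ (m - 1))⁻¹ * totalCdf N σ m (b * m + (m - 1)) 0 := by
        intro b
        rw [inv_mul_eq_div, le_div_iff₀ (by positivity), mul_comm]
        have := pow_mul_totalCdf_le (N := N) h0.le h1.le m b (m - 1) c (by omega)
        rwa [show c - (m - 1) = 0 by omega] at this
      refine squeeze_zero (fun b => totalCdf_nonneg h0.le h1.le _ _ _) e ?_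
      simpa using (tendsto_totalCdf_zero h0 h1.le hm h).const_mul (σ ^ (m - 1))⁻¹
    · have e : ∀ b, totalCdf N σ m (b * m) c ≤
          (σ ^ m)⁻¹ * totalCdf N σ m ((b + 1) * m) (c - m + N) := by
        intro b
        rw [inv_mul_eq_div, le_div_iff₀ (by positivity), mul_comm]
        exact pow_period_mul_totalCdf_le h0.le h1.le hm b c
      refine squeeze_zero (fun b => totalCdf_nonneg h0.le h1.le _ _ _) e ?_
      have := (tendsto_add_atTop_iff_nat (f := fun b => totalCdf N σ m (b * m) (c - m + N)) 1).2
        (ih (c - m + N) (by omega))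
      simpa using this.const_mul (σ ^ m)⁻¹

/-- Chernoff bound: `θ ^ total` is at least `θ ^ c` on the event, while its mean decays
geometrically. -/
lemma tendsto_totalCdf_of_lt {σ : ℝ} (h0 : 0 ≤ σ) (h1 : σ ≤ 1) {m : ℕ} (hm : 1 ≤ m)
    (h : m * σ < (N : ℝ)) (c : ℕ) :
    Tendsto (fun b => totalCdf N σ m (b * m) c) atTop (𝓝 0) := by
  obtain ⟨θ, hθ0, hθ1, hρ⟩ := exists_lt_one_periodFactor_lt_one h
  have hγ : 0 ≤ 1 - σ + σ / θ := add_nonneg (by linarith) (by positivity)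
  have e : ∀ b, totalCdf N σ m (b * m) c ≤
      (θ ^ c)⁻¹ * (θ ^ N * (1 - σ + σ / θ) ^ m) ^ b := by
    intro b
    calc totalCdf N σ m (b * m) c
        ≤ evol σ m 0 (b * m) (fun x : Fin N → ℕ => (θ ^ c)⁻¹ * θ ^ total x) 0 := by
          refine evol_mono h0 h1 _ _ _ (fun L => ?_) 0
          dsimp only
          split_ifs with hL
          · rw [inv_mul_eq_div, one_le_div (by positivity)]
            exact pow_le_pow_of_le_one hθ0.le hθ1.le hL
          · positivity
      _ ≤ _ := by
          rw [evol_mul_left]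
          gcongr
          refine (evol_pow_total_le h0 h1 hθ0 hθ1.le m (b * m)).trans_eq ?_
          rw [Nat.mul_div_cancel _ hm, mul_pow, ← pow_mul, ← pow_mul, mul_comm b m]
          ring
  refine squeeze_zero (fun b => totalCdf_nonneg h0 h1 _ _ _) e ?_
  simpa using (tendsto_pow_atTop_nhds_zero_of_lt_one (by positivity) hρ).const_mul (θ ^ c)⁻¹

/-! ### From the total to the longest queue -/

/-- The indicator function of the event that some queue is longer than `c`. -/
noncomputable def exceeds (c : ℕ) (L : Fin N → ℕ) : ℝ := if ∀ i, L i ≤ c then 0 else 1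

lemma exceeds_monotone (c : ℕ) : Monotone (exceeds (N := N) c) := by
  intro L L' h
  unfold exceeds
  split_ifs with h1 h2 h2
  · exact le_rfl
  · exact zero_le_one
  · exact absurd (fun i => (h i).trans (h2 i)) h1
  · exact le_rfl

lemma exceeds_nonneg (c : ℕ) (L : Fin N → ℕ) : 0 ≤ exceeds c L := by
  unfold exceeds; split_ifs <;> norm_num

lemma exceeds_le_one (c : ℕ) (L : Fin N → ℕ) : exceeds c L ≤ 1 := by
  unfold exceeds; split_ifs <;> norm_num

lemma evol_exceeds_le_one {σ : ℝ} (h0 : 0 ≤ σ) (h1 : σ ≤ 1) (m k n c : ℕ) (L : Fin N → ℕ) :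
    evol σ m k n (exceeds c) L ≤ 1 := by
  have := evol_mono h0 h1 m k n (f := exceeds c) (g := fun _ => 1) (exceeds_le_one c) L
  rwa [evol_const] at this

/-- At and above the critical load, the queues grow beyond every bound in probability. -/
lemma tendsto_evol_exceeds_one {σ : ℝ} (h0 : 0 < σ) (h1 : σ < 1) {m : ℕ} (hm : 1 ≤ m)
    (h : m * σ ≤ (N : ℝ)) (n c : ℕ) :
    Tendsto (fun b => evol σ m 0 (b * m + n) (exceeds (N := N) c) 0) atTop (𝓝 1) := by
  have hT : ∀ c, Tendsto (fun b => totalCdf N σ m (b * m) c) atTop (𝓝 0) := by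
    rcases h.lt_or_eq with h | h
    · exact tendsto_totalCdf_of_lt h0.le h1.le hm h
    · exact tendsto_totalCdf_of_eq h0 h1 hm h.symm
  -- A total above `N * c` forces some queue above `c`, and `n` slots remove at most `n` packets.
  have e : ∀ b, 1 - totalCdf N σ m (b * m) (N * c + n) ≤
      evol σ m 0 (b * m + n) (exceeds (N := N) c) 0 := by
    intro b
    have e1 := totalCdf_add_le (N := N) h0.le h1.le m (b * m) n (N * c)
    have e2 : evol σ m 0 (b * m + n)
        (fun x : Fin N → ℕ => -1 * (if total x ≤ N * c then 1 else 0) + 1) 0 ≤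
        evol σ m 0 (b * m + n) (exceeds (N := N) c) 0 := by
      refine evol_mono h0.le h1.le _ _ _ (fun L => ?_) 0
      unfold exceeds
      dsimp only
      split_ifs with h2 h3 h3
      · norm_num
      · norm_num
      · refine absurd ?_ h2
        simpa [total] using Finset.sum_le_card_nsmul Finset.univ L c fun i _ => h3 i
      · norm_num
    rw [evol_add_const] at e2
    change -1 * totalCdf N σ m (b * m + n) (N * c) + 1 ≤ _ at e2
    linarith
  refine tendsto_of_tendsto_of_tendsto_of_le_of_le ?_ tendsto_const_nhds e
    (fun b => evol_exceeds_le_one h0.le h1.le _ _ _ _ _)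
  simpa using (hT (N * c + n)).const_sub 1

end Unstable

/-! ### The law of the queue lengths in a slot -/

section PMF

variable {α β : Type*} [MeasurableSpace α] [Countable α] [MeasurableSingletonClass α]
  [MeasurableSpace β] [Countable β] [MeasurableSingletonClass β]

lemma lintegral_toMeasure (p : PMF α) (f : α → ℝ≥0∞) :
    ∫⁻ a, f a ∂p.toMeasure = ∑' a, p a * f a := by
  rw [lintegral_countable']
  exact tsum_congr fun a => by
    rw [PMF.toMeasure_apply_singleton _ _ (measurableSet_singleton a), mul_comm]

lemma lintegral_toMeasure_bind (p : PMF α) (q : α → PMF β) (f : β → ℝ≥0∞) :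
    ∫⁻ b, f b ∂(p.bind q).toMeasure = ∫⁻ a, ∫⁻ b, f b ∂(q a).toMeasure ∂p.toMeasure := by
  simp only [lintegral_toMeasure, PMF.bind_apply, ← ENNReal.tsum_mul_left, ← ENNReal.tsum_mul_right]
  rw [ENNReal.tsum_comm]
  simp only [mul_assoc]

lemma lintegral_toMeasure_map (p : PMF α) (h : α → β) (f : β → ℝ≥0∞) :
    ∫⁻ b, f b ∂(p.map h).toMeasure = ∫⁻ a, f (h a) ∂p.toMeasure := by
  rw [← PMF.toMeasure_map (f := h) p Measurable.of_discrete, lintegral_map Measurable.of_discrete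
    Measurable.of_discrete]

end PMF

lemma lintegral_toMeasure_pure {α : Type*} [MeasurableSpace α] [MeasurableSingletonClass α] (a : α)
    (f : α → ℝ≥0∞) : ∫⁻ b, f b ∂(PMF.pure a).toMeasure = f a := by
  rw [PMF.toMeasure_pure, lintegral_dirac]

section Law

variable {N : ℕ}

lemma lintegral_serviceLaw (σ : ℝ≥0) (hσ : σ ≤ 1) (L : Fin N → ℕ) (f : Fin (N + 1) → ℝ≥0∞) :
    ∫⁻ M, f M ∂(serviceLaw σ hσ L).toMeasure =
      if (contending L).Nonempty then
        (1 - σ : ℝ≥0) * f 0 +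
          σ * ((∑ j ∈ contending L, f j.succ) / ((contending L).card : ℝ≥0∞))
      else f 0 := by
  classical
  unfold serviceLaw
  split_ifs with h
  · rw [lintegral_toMeasure_bind, lintegral_toMeasure, tsum_fintype, Fintype.sum_bool]
    simp only [if_true, Bool.false_eq_true, if_false, lintegral_toMeasure_map,
      lintegral_toMeasure_pure, PMF.bernoulli_apply, cond_true, cond_false]
    rw [lintegral_toMeasure, tsum_fintype, add_comm]
    simp only [PMF.uniformOfFinset_apply, ite_mul, zero_mul, Finset.sum_ite_mem, Finset.univ_inter,
      ← Finset.mul_sum]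
    rw [ENNReal.div_eq_inv_mul]
  · exact lintegral_toMeasure_pure _ _

lemma nextQueues_zero (m k : ℕ) (L : Fin N → ℕ) : nextQueues m k (L, 0) = arrive m k L := by
  funext i
  simp [nextQueues, arrive, (Fin.succ_ne_zero i).symm]

lemma nextQueues_succ (m k : ℕ) (L : Fin N → ℕ) (j : Fin N) :
    nextQueues m k (L, j.succ) = arrive m k (depart j L) := by
  funext i
  simp [nextQueues, arrive, depart]

lemma lintegral_stateLaw_nextQueues (σ : ℝ≥0) (hσ : σ ≤ 1) (m k : ℕ) {g : (Fin N → ℕ) → ℝ}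
    (hg : ∀ x, 0 ≤ g x) (L : Fin N → ℕ) :
    ∫⁻ s, ENNReal.ofReal (g (nextQueues m k s)) ∂(stateLaw σ hσ L).toMeasure =
      ENNReal.ofReal (step σ m k g L) := by
  rw [stateLaw, lintegral_toMeasure_map, lintegral_serviceLaw]
  simp only [nextQueues_zero, nextQueues_succ, step, serve]
  split_ifs with h
  · have hc : (0 : ℝ) < (contending L).card := by exact_mod_cast h.card_pos
    have h1 : (0 : ℝ) ≤ 1 - σ := sub_nonneg.2 (by exact_mod_cast hσ)
    have hs : 0 ≤ ∑ j ∈ contending L, g (arrive m k (depart j L)) :=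
      Finset.sum_nonneg fun j _ => hg _
    rw [ENNReal.ofReal_add (mul_nonneg h1 (hg _)) (by positivity), ENNReal.ofReal_mul h1,
      ENNReal.ofReal_mul σ.coe_nonneg, ENNReal.ofReal_div_of_pos hc,
      ENNReal.ofReal_sum_of_nonneg fun j _ => hg _, ENNReal.ofReal_natCast,
      ENNReal.ofReal_coe_nnreal, ← NNReal.coe_one, ← NNReal.coe_sub hσ, ENNReal.ofReal_coe_nnreal]
  · rfl

lemma ae_stateLaw (σ : ℝ≥0) (hσ : σ ≤ 1) (L : Fin N → ℕ) :
    ∀ᵐ s ∂(stateLaw σ hσ L).toMeasure, s.1 = L ∧ ∀ i : Fin N, s.2 = i.succ → 0 < s.1 i := by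
  classical
  have h : ∫⁻ s, (if s.1 = L ∧ ∀ i : Fin N, s.2 = i.succ → 0 < s.1 i then 0 else 1)
      ∂(stateLaw σ hσ L).toMeasure = 0 := by
    rw [stateLaw, lintegral_toMeasure_map, lintegral_serviceLaw]
    have h0 : ∀ i : Fin N, (0 : Fin (N + 1)) ≠ i.succ := fun i => (Fin.succ_ne_zero i).symm
    have hs : ∑ j ∈ contending L,
        (if L = L ∧ ∀ i : Fin N, j.succ = i.succ → 0 < L i then (0 : ℝ≥0∞) else 1) = 0 :=
      Finset.sum_eq_zero fun j hj => by
        simpa [Nat.pos_iff_ne_zero] using mem_contending.1 hj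
    simp only [] at hs ⊢
    rw [hs]
    simp [h0]
  rw [lintegral_eq_zero_iff Measurable.of_discrete] at h
  filter_upwards [h] with s hs
  by_contra hc
  simp [hc] at hs

variable (m : ℕ) (σ : ℝ≥0) (hσ : σ ≤ 1) (init : PMF (Fin N → ℕ))

instance : IsProbabilityMeasure (pathLaw N m σ hσ init) := by
  unfold pathLaw; infer_instance

lemma lintegral_pathLaw_zero (G : State N → ℝ≥0∞) :
    ∫⁻ ω, G (ω 0) ∂pathLaw N m σ hσ init =
      ∫⁻ L, ∫⁻ s, G s ∂(stateLaw σ hσ L).toMeasure ∂init.toMeasure := by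
  have hG : Measurable fun ω : ℕ → State N => G (ω 0) :=
    (Measurable.of_discrete (f := G)).comp (measurable_pi_apply 0)
  rw [pathLaw, Kernel.trajMeasure, Measure.lintegral_bind (by fun_prop) hG.aemeasurable,
    ← lintegral_toMeasure_bind]
  rw [lintegral_map]
  · refine lintegral_congr fun s => ?_
    rw [Kernel.lintegral_traj _ hG]
    simp [Function.updateFinset]
  · exact Measurable.of_discrete
  · fun_prop

lemma lintegral_pathLaw_succ (k : ℕ) (G : State N → State N → ℝ≥0∞) :
    ∫⁻ ω, G (ω k) (ω (k + 1)) ∂pathLaw N m σ hσ init =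
      ∫⁻ ω, ∫⁻ s, G (ω k) s ∂(stateLaw σ hσ (nextQueues m k (ω k))).toMeasure
        ∂pathLaw N m σ hσ init := by
  have h := Kernel.map_frestrictLe_trajMeasure_compProd_eq_map_trajMeasure
    (X := fun _ => State N) (μ₀ := (init.bind (stateLaw σ hσ)).toMeasure)
    (κ := slotKernel N m σ hσ) (a := k)
  change (pathLaw N m σ hσ init).map _ ⊗ₘ _ = (pathLaw N m σ hσ init).map _ at h
  have hG : Measurable fun p : (∀ _ : Finset.Iic k, State N) × State N =>
      G (p.1 ⟨k, Finset.mem_Iic.2 le_rfl⟩) p.2 := Measurable.of_discrete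
  have h2 := congrArg (fun μ => ∫⁻ p, G (p.1 ⟨k, Finset.mem_Iic.2 le_rfl⟩) p.2 ∂μ) h
  beta_reduce at h2
  rw [lintegral_map hG (by fun_prop), Measure.lintegral_compProd hG,
    lintegral_map Measurable.of_discrete (by fun_prop)] at h2
  exact h2.symm

lemma ae_pathLaw_succ (k : ℕ) :
    ∀ᵐ ω ∂pathLaw N m σ hσ init, (ω (k + 1)).1 = nextQueues m k (ω k) ∧
      ∀ i : Fin N, (ω (k + 1)).2 = i.succ → 0 < (ω (k + 1)).1 i := by
  classical
  have h := lintegral_pathLaw_succ m σ hσ init k fun s s' =>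
    if s'.1 = nextQueues m k s ∧ ∀ i : Fin N, s'.2 = i.succ → 0 < s'.1 i then 0 else 1
  have hz : ∀ L : Fin N → ℕ, ∫⁻ s : State N,
      (if s.1 = L ∧ ∀ i : Fin N, s.2 = i.succ → 0 < s.1 i then 0 else 1)
        ∂(stateLaw σ hσ L).toMeasure = 0 := by
    intro L
    rw [lintegral_eq_zero_iff Measurable.of_discrete]
    filter_upwards [ae_stateLaw σ hσ L] with s hs
    exact if_pos hs
  simp only [hz, lintegral_zero] at h
  rw [lintegral_eq_zero_iff] at h
  · filter_upwards [h] with ω hω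
    by_contra hc
    simp [hc] at hω
  · exact (Measurable.of_discrete (f := fun p : State N × State N =>
      if p.2.1 = nextQueues m k p.1 ∧ ∀ i : Fin N, p.2.2 = i.succ → 0 < p.2.1 i
        then (0 : ℝ≥0∞) else 1)).comp
      (f := fun ω : ℕ → State N => (ω k, ω (k + 1))) (by fun_prop)

lemma ae_pathLaw_zero :
    ∀ᵐ ω ∂pathLaw N m σ hσ init, ∀ i : Fin N, (ω 0).2 = i.succ → 0 < (ω 0).1 i := by
  classical
  have h := lintegral_pathLaw_zero m σ hσ init fun s =>
    if ∀ i : Fin N, s.2 = i.succ → 0 < s.1 i then 0 else 1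
  have hz : ∀ L : Fin N → ℕ, ∫⁻ s : State N,
      (if ∀ i : Fin N, s.2 = i.succ → 0 < s.1 i then 0 else 1)
        ∂(stateLaw σ hσ L).toMeasure = 0 := by
    intro L
    rw [lintegral_eq_zero_iff Measurable.of_discrete]
    filter_upwards [ae_stateLaw σ hσ L] with s hs
    exact if_pos hs.2
  simp only [hz, lintegral_zero] at h
  rw [lintegral_eq_zero_iff] at h
  · filter_upwards [h] with ω hω
    by_contra hc
    simp [hc] at hω
  · exact (Measurable.of_discrete (f := fun s : State N =>
      if ∀ i : Fin N, s.2 = i.succ → 0 < s.1 i then (0 : ℝ≥0∞) else 1)).comp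
      (f := fun ω : ℕ → State N => ω 0) (by fun_prop)

/-- Almost surely, the queue lengths follow their recursion, and only nonempty queues are served. -/
lemma ae_pathLaw :
    ∀ᵐ ω ∂pathLaw N m σ hσ init, ∀ k, (ω (k + 1)).1 = nextQueues m k (ω k) ∧
      ∀ i : Fin N, (ω k).2 = i.succ → 0 < (ω k).1 i := by
  filter_upwards [ae_all_iff.2 (ae_pathLaw_succ m σ hσ init), ae_pathLaw_zero m σ hσ init]
    with ω h h0 k
  refine ⟨(h k).1, ?_⟩
  cases k with
  | zero => exact h0
  | succ k => exact (h k).2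

/-- Conditionally on the queue lengths, the successful node has law `serviceLaw`. -/
lemma lintegral_pathLaw_eq (k : ℕ) (G : State N → ℝ≥0∞) :
    ∫⁻ ω, G (ω k) ∂pathLaw N m σ hσ init =
      ∫⁻ ω, ∫⁻ s, G s ∂(stateLaw σ hσ (ω k).1).toMeasure ∂pathLaw N m σ hσ init := by
  -- A state drawn from `stateLaw` records `L` itself, so redrawing the service from its queue
  -- lengths does not change the law.
  have key : ∀ L : Fin N → ℕ, ∫⁻ s : State N, ∫⁻ s', G s' ∂(stateLaw σ hσ s.1).toMeasure
      ∂(stateLaw σ hσ L).toMeasure = ∫⁻ s', G s' ∂(stateLaw σ hσ L).toMeasure := by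
    intro L
    rw [lintegral_congr_ae (g := fun _ => ∫⁻ s', G s' ∂(stateLaw σ hσ L).toMeasure)]
    · rw [lintegral_const, measure_univ, mul_one]
    · filter_upwards [ae_stateLaw σ hσ L] with s hs
      rw [hs.1]
  cases k with
  | zero =>
    rw [lintegral_pathLaw_zero m σ hσ init G, lintegral_pathLaw_zero m σ hσ init
      fun s => ∫⁻ s', G s' ∂(stateLaw σ hσ s.1).toMeasure]
    simp only [key]
  | succ k =>
    rw [lintegral_pathLaw_succ m σ hσ init k fun _ => G, lintegral_pathLaw_succ m σ hσ init k
      fun _ s => ∫⁻ s', G s' ∂(stateLaw σ hσ s.1).toMeasure]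
    simp only [key]

/-- Expectations of functions of the queue lengths in slot `k` are given by `evol`. -/
lemma lintegral_pathLaw_queues (k : ℕ) {g : (Fin N → ℕ) → ℝ} (hg : ∀ x, 0 ≤ g x) :
    ∫⁻ ω, ENNReal.ofReal (g (ω k).1) ∂pathLaw N m σ hσ init =
      ∫⁻ L, ENNReal.ofReal (evol σ m 0 k g L) ∂init.toMeasure := by
  have h0 : (0 : ℝ) ≤ σ := σ.coe_nonneg
  have h1 : (σ : ℝ) ≤ 1 := by exact_mod_cast hσ
  induction k generalizing g with
  | zero =>
    rw [lintegral_pathLaw_zero m σ hσ init fun s => ENNReal.ofReal (g s.1)]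
    refine lintegral_congr fun L => ?_
    rw [stateLaw, lintegral_toMeasure_map]
    dsimp only
    rw [lintegral_const, measure_univ, mul_one]
    rfl
  | succ k ih =>
    have hs : ∀ x, 0 ≤ step (σ : ℝ) m k g x := evol_nonneg h0 h1 m k 1 hg
    calc ∫⁻ ω, ENNReal.ofReal (g (ω (k + 1)).1) ∂pathLaw N m σ hσ init
        = ∫⁻ ω, ENNReal.ofReal (g (nextQueues m k (ω k))) ∂pathLaw N m σ hσ init := by
          refine lintegral_congr_ae ?_
          filter_upwards [ae_pathLaw m σ hσ init] with ω hω
          rw [(hω k).1]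
      _ = ∫⁻ ω, ENNReal.ofReal (step (σ : ℝ) m k g (ω k).1) ∂pathLaw N m σ hσ init := by
          rw [lintegral_pathLaw_eq m σ hσ init k fun s => ENNReal.ofReal (g (nextQueues m k s))]
          simp only [lintegral_stateLaw_nextQueues σ hσ m k hg]
      _ = _ := by rw [ih hs, evol_succ, zero_add]

end Law

/-! ### Batch delays and queue lengths -/

section Delay

variable {N : ℕ}

lemma departures_succ (ω : ℕ → State N) (i : Fin N) (k : ℕ) :
    departures ω i (k + 1) = departures ω i k + if (ω k).2 = i.succ then 1 else 0 := by
  unfold departures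
  rw [Finset.range_add_one, Finset.filter_insert]
  split_ifs
  · rw [Finset.card_insert_of_notMem (by simp)]
  · rfl

lemma departures_mono (ω : ℕ → State N) (i : Fin N) : Monotone (departures ω i) :=
  monotone_nat_of_le_succ fun k => by rw [departures_succ]; exact Nat.le_add_right _ _

/-- Conservation of packets. -/
lemma departures_add_queue {m : ℕ} {ω : ℕ → State N}
    (h : ∀ k, (ω (k + 1)).1 = nextQueues m k (ω k) ∧
      ∀ i : Fin N, (ω k).2 = i.succ → 0 < (ω k).1 i) (i : Fin N) (k : ℕ) :
    departures ω i k + (ω k).1 i = (ω 0).1 i + k / m := by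
  induction k with
  | zero => simp [departures]
  | succ k ih =>
    rw [departures_succ, (h k).1, Nat.succ_div]
    have := (h k).2 i
    simp only [nextQueues]
    split_ifs with h1 h2 h2
    all_goals first
      | (have := this h1; omega)
      | omega

lemma receptionTime_le_iff (ω : ℕ → State N) (i : Fin N) (b n : ℕ) :
    receptionTime ω i b ≤ (n : ℕ∞) ↔ (ω 0).1 i + b ≤ departures ω i n := by
  constructor
  · intro h
    by_contra hc
    have : ((n + 1 : ℕ) : ℕ∞) ≤ receptionTime ω i b := by
      refine le_iInf₂ fun k hk => ?_
      rw [Nat.cast_le]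
      by_contra hkn
      exact hc (hk.trans (departures_mono ω i (by omega)))
    have := this.trans h
    rw [Nat.cast_le] at this
    omega
  · exact fun h => iInf₂_le n h

/-- By time `b * m + n` each node has received `b + n / m` packets beyond its initial queue. Batch
`b` has left a first-in-first-out queue exactly when at most the `n / m` later packets remain. -/
lemma batchDelay_le_iff {m : ℕ} (hm : 1 ≤ m) {ω : ℕ → State N}
    (h : ∀ k, (ω (k + 1)).1 = nextQueues m k (ω k) ∧
      ∀ i : Fin N, (ω k).2 = i.succ → 0 < (ω k).1 i) (b n : ℕ) :
    batchDelay m ω b ≤ (n : ℕ∞) ↔ ∀ i, (ω (b * m + n)).1 i ≤ n / m := by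
  unfold batchDelay
  rw [iSup_le_iff]
  refine forall_congr' fun i => ?_
  rw [tsub_le_iff_left, ← Nat.cast_add, receptionTime_le_iff]
  have := departures_add_queue h i (b * m + n)
  rw [mul_comm, Nat.mul_add_div hm] at this
  rw [mul_comm]
  omega

lemma pathLaw_batchDelay_le {m : ℕ} (hm : 1 ≤ m) (σ : ℝ≥0) (hσ : σ ≤ 1)
    (init : PMF (Fin N → ℕ)) (b n : ℕ) :
    pathLaw N m σ hσ init {ω | batchDelay m ω b ≤ (n : ℕ∞)} =
      ∫⁻ L, ENNReal.ofReal (1 - evol σ m 0 (b * m + n) (exceeds (n / m)) L) ∂init.toMeasure := by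
  have e : (fun L : Fin N → ℕ => if ∀ i, L i ≤ n / m then (1 : ℝ) else 0) =
      fun L => -1 * exceeds (n / m) L + 1 := by
    funext L; unfold exceeds; split_ifs <;> norm_num
  have h2 := lintegral_pathLaw_queues m σ hσ init (b * m + n)
    (g := fun L => if ∀ i, L i ≤ n / m then 1 else 0) (fun x => by split_ifs <;> norm_num)
  have hS : MeasurableSet {ω : ℕ → State N | ∀ i, (ω (b * m + n)).1 i ≤ n / m} :=
    (MeasurableSet.of_discrete (s := {s : State N | ∀ i, s.1 i ≤ n / m})).preimage
      (measurable_pi_apply (b * m + n))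
  have h3 : pathLaw N m σ hσ init {ω | batchDelay m ω b ≤ (n : ℕ∞)} =
      pathLaw N m σ hσ init {ω | ∀ i, (ω (b * m + n)).1 i ≤ n / m} := by
    refine measure_congr ?_
    filter_upwards [ae_pathLaw m σ hσ init] with ω hω
    exact propext (batchDelay_le_iff hm hω b n)
  rw [h3, ← lintegral_indicator_one hS]
  calc _ = ∫⁻ ω, ENNReal.ofReal (if ∀ i, (ω (b * m + n)).1 i ≤ n / m then 1 else 0)
        ∂pathLaw N m σ hσ init := by
        refine lintegral_congr fun ω => ?_
        simp only [Set.indicator, Set.mem_ofPred_eq]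
        split_ifs <;> simp
    _ = _ := by
        rw [h2, e]
        refine lintegral_congr fun L => ?_
        rw [evol_add_const]
        congr 1
        ring

end Delay

/-! ### Probability laws on `ℕ∞` -/

section ENatLaws

instance : BorelSpace ℕ∞ where
  measurable_eq := by
    refine le_antisymm (fun s _ => ?_) le_top
    let _ : MeasurableSpace ℕ∞ := borel ℕ∞
    have : BorelSpace ℕ∞ := ⟨rfl⟩
    exact s.to_countable.measurableSet

/-- Quantile transform of a uniform variable on `(0, 1]`. The supremum of `F` may be below `1`; the
missing mass goes to `⊤`, the value of the infimum over the empty set. -/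
lemma exists_measure_Iic_eq {F : ℕ → ℝ} (hF : Monotone F) (h1 : ∀ n, F n ≤ 1) :
    ∃ ν : Measure ℕ∞, IsProbabilityMeasure ν ∧
      ∀ n : ℕ, ν (Set.Iic (n : ℕ∞)) = ENNReal.ofReal (F n) := by
  set X : ℝ → ℕ∞ := fun u => ⨅ (n : ℕ) (_ : u ≤ F n), (n : ℕ∞) with hX
  have hXle : ∀ u (n : ℕ), X u ≤ n ↔ u ≤ F n := by
    intro u n
    constructor
    · intro h
      by_contra hc
      have h2 : ((n + 1 : ℕ) : ℕ∞) ≤ X u := by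
        refine le_iInf₂ fun k hk => ?_
        rw [Nat.cast_le]
        by_contra hkn
        exact hc (hk.trans (hF (by omega)))
      have := h2.trans h
      rw [Nat.cast_le] at this
      omega
    · exact fun h => iInf₂_le n h
  have hmono : Monotone X := fun u v huv => le_iInf₂ fun n hn => iInf₂_le n (huv.trans hn)
  have hmeas : Measurable X := hmono.measurable
  have hprob : IsProbabilityMeasure (volume.restrict (Set.Ioc (0 : ℝ) 1)) := ⟨by simp⟩
  refine ⟨(volume.restrict (Set.Ioc (0 : ℝ) 1)).map X,
    Measure.isProbabilityMeasure_map hmeas.aemeasurable, fun n => ?_⟩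
  rw [Measure.map_apply hmeas measurableSet_Iic,
    Measure.restrict_apply (hmeas measurableSet_Iic)]
  have : X ⁻¹' Set.Iic (n : ℕ∞) ∩ Set.Ioc 0 1 = Set.Ioc 0 (F n) := by
    ext u
    simp only [Set.mem_inter_iff, Set.mem_preimage, Set.mem_Iic, hXle, Set.mem_Ioc]
    exact ⟨fun h => ⟨h.2.1, h.1⟩, fun h => ⟨h.2, h.1, h.2.trans (h1 n)⟩⟩
  rw [this, Real.volume_Ioc, sub_zero]

lemma measure_ext_of_Iic {μ ν : Measure ℕ∞} [IsProbabilityMeasure μ] [IsProbabilityMeasure ν]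
    (h : ∀ n : ℕ, μ (Set.Iic (n : ℕ∞)) = ν (Set.Iic (n : ℕ∞))) : μ = ν := by
  refine Measure.ext_of_Iic μ ν fun a => ?_
  induction a using ENat.recTopCoe with
  | top => simp
  | coe n => exact h n

/-- Any `d`, including `⊤`, is the number of naturals below it. -/
lemma lintegral_toENNReal_eq_tsum (ν : Measure ℕ∞) :
    ∫⁻ d, (d : ℝ≥0∞) ∂ν = ∑' n : ℕ, ν (Set.Ioi (n : ℕ∞)) := by
  have e : ∀ d : ℕ∞, (d : ℝ≥0∞) = ∑' n : ℕ, (Set.Ioi (n : ℕ∞)).indicator 1 d := by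
    intro d
    induction d using ENat.recTopCoe with
    | top => simp
    | coe k =>
      rw [tsum_eq_sum (s := Finset.range k)]
      · rw [Finset.sum_congr rfl (g := fun _ => (1 : ℝ≥0∞))]
        · simp
        · intro n hn
          exact Set.indicator_of_mem (by simpa using hn) _
      · intro n hn
        exact Set.indicator_of_notMem (by simpa using hn) _
  simp only [e]
  rw [lintegral_tsum fun n => Measurable.of_discrete.aemeasurable]
  exact tsum_congr fun n => lintegral_indicator_one measurableSet_Ioi

lemma HasFiniteMean.isProper {ν : Measure ℕ∞} (h : HasFiniteMean ν) : IsProper ν := by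
  have h2 := ae_lt_top (μ := ν) (f := fun d : ℕ∞ => (d : ℝ≥0∞)) Measurable.of_discrete h.ne
  have h3 : ∀ᵐ d ∂ν, d ≠ ⊤ := by
    filter_upwards [h2] with d hd hd'
    simp [hd'] at hd
  rw [ae_iff] at h3
  unfold IsProper
  convert h3 using 2
  ext d
  simp

lemma not_isProper_of_Iic_eq_zero {ν : Measure ℕ∞} [IsProbabilityMeasure ν]
    (h : ∀ n : ℕ, ν (Set.Iic (n : ℕ∞)) = 0) : ¬ IsProper ν := by
  intro hp
  have hu : (Set.univ : Set ℕ∞) = {⊤} ∪ ⋃ n : ℕ, Set.Iic (n : ℕ∞) := by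
    ext d
    induction d using ENat.recTopCoe with
    | top => simp
    | coe k => simpa using ⟨k, le_rfl⟩
  have : ν Set.univ = 0 := by
    rw [hu, measure_union_null_iff]
    exact ⟨hp, measure_iUnion_null h⟩
  simp at this

lemma summable_pow_div {q : ℝ} (hq0 : 0 < q) (hq1 : q < 1) {m : ℕ} (hm : 1 ≤ m) :
    Summable fun n : ℕ => q ^ (n / m) := by
  -- The `m`-th root of `q` turns the step function `n / m` into a true geometric majorant, at the
  -- cost of a factor `q⁻¹`.
  set s := q ^ ((m : ℝ)⁻¹) with hs
  have hs0 : 0 < s := Real.rpow_pos_of_pos hq0 _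
  have hs1 : s < 1 := Real.rpow_lt_one hq0.le hq1 (by positivity)
  have hsm : s ^ m = q := Real.rpow_inv_natCast_pow hq0.le (by omega)
  refine Summable.of_nonneg_of_le (fun n => by positivity) (fun n => ?_)
    ((summable_geometric_of_lt_one hs0.le hs1).mul_left q⁻¹)
  rw [inv_mul_eq_div, le_div_iff₀ hq0]
  calc q ^ (n / m) * q = s ^ (m * (n / m) + m) := by rw [pow_add, pow_mul, hsm]
    _ ≤ s ^ n := pow_le_pow_of_le_one hs0.le hs1.le (by
        have := Nat.div_add_mod n m
        have := Nat.mod_lt n hm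
        omega)

end ENatLaws

/-! ### Convergence of the batch delay -/

section Limit

variable {N : ℕ}

/-- The limit, as `b → ∞`, of the probability that the delay of batch `b` exceeds `n`, for the
system that starts empty. -/
noncomputable def limitTail (N : ℕ) (σ : ℝ) (m n : ℕ) : ℝ :=
  ⨆ b : ℕ, evol σ m 0 (b * m + n) (exceeds (N := N) (n / m)) 0

lemma tendsto_evol_zero_limitTail {σ : ℝ} (h0 : 0 ≤ σ) (h1 : σ ≤ 1) (m n : ℕ) :
    Tendsto (fun b => evol σ m 0 (b * m + n) (exceeds (N := N) (n / m)) 0) atTop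
      (𝓝 (limitTail N σ m n)) := by
  refine tendsto_atTop_ciSup (monotone_nat_of_le_succ fun b => ?_)
    ⟨1, by rintro _ ⟨b, rfl⟩; exact evol_exceeds_le_one h0 h1 _ _ _ _ _⟩
  have := evol_zero_le_add_period h0 h1 m (b * m + n) (exceeds_monotone (N := N) (n / m))
  rwa [show b * m + n + m = (b + 1) * m + n by ring] at this

/-- The empty start is a lower bound by monotonicity. The upper bound is the vanishing influence of
`L` below the critical load, and the trivial bound `1` otherwise. -/
lemma tendsto_evol_limitTail {σ : ℝ} (h0 : 0 < σ) (h1 : σ < 1) {m : ℕ} (hm : 1 ≤ m) (n : ℕ)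
    (L : Fin N → ℕ) :
    Tendsto (fun b => evol σ m 0 (b * m + n) (exceeds (n / m)) L) atTop
      (𝓝 (limitTail N σ m n)) := by
  have hz := tendsto_evol_zero_limitTail (N := N) h0.le h1.le m n
  have hle : ∀ b, evol σ m 0 (b * m + n) (exceeds (n / m)) 0 ≤
      evol σ m 0 (b * m + n) (exceeds (n / m)) L := fun b =>
    evol_monotone h0.le h1.le _ _ _ (exceeds_monotone _) (Pi.le_def.2 fun _ => Nat.zero_le _)
  rcases lt_or_ge (N : ℝ) (m * σ) with h | h
  · obtain ⟨θ, hθ, hρ⟩ := exists_one_lt_periodFactor_lt_one h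
    have hγ : 0 ≤ 1 - σ + σ / θ := add_nonneg (by linarith) (by positivity)
    have hγ1 : 1 - σ + σ / θ ≤ 1 := by
      have : σ / θ ≤ σ := div_le_self h0.le hθ.le
      linarith
    have hup : ∀ b, evol σ m 0 (b * m + n) (exceeds (n / m)) L ≤
        evol σ m 0 (b * m + n) (exceeds (N := N) (n / m)) 0 +
          (θ ^ N * (1 - σ + σ / θ) ^ m) ^ b * θ ^ total L := by
      intro b
      have e := evol_le_evol_zero_add h0.le h1.le hθ.le m 0 (b * m + n)
        (exceeds_monotone (N := N) (n / m)) (exceeds_nonneg _) (exceeds_le_one _) L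
      rw [zero_add, Nat.zero_div, mul_zero, Nat.sub_zero] at e
      refine e.trans ?_
      gcongr
      refine (pow_mul_pow_div_le hγ hγ1 (by positivity) m _).trans ?_
      refine pow_le_pow_of_le_one (by positivity) hρ.le ?_
      rw [Nat.le_div_iff_mul_le hm]
      omega
    refine tendsto_of_tendsto_of_tendsto_of_le_of_le hz ?_ hle hup
    have hpow := tendsto_pow_atTop_nhds_zero_of_lt_one
      (r := θ ^ N * (1 - σ + σ / θ) ^ m) (by positivity) hρ
    simpa using hz.add (hpow.mul_const (θ ^ total L))
  · have hone := tendsto_evol_exceeds_one h0 h1 hm h n (n / m)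
    rw [tendsto_nhds_unique hz hone]
    exact tendsto_of_tendsto_of_tendsto_of_le_of_le hone tendsto_const_nhds hle
      fun b => evol_exceeds_le_one h0.le h1.le _ _ _ _ _

lemma limitTail_nonneg {σ : ℝ} (h0 : 0 ≤ σ) (h1 : σ ≤ 1) (m n : ℕ) : 0 ≤ limitTail N σ m n :=
  ge_of_tendsto' (tendsto_evol_zero_limitTail h0 h1 m n) fun _ =>
    evol_nonneg h0 h1 _ _ _ (exceeds_nonneg _) _

lemma limitTail_le_one {σ : ℝ} (h0 : 0 ≤ σ) (h1 : σ ≤ 1) (m n : ℕ) : limitTail N σ m n ≤ 1 :=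
  le_of_tendsto' (tendsto_evol_zero_limitTail h0 h1 m n) fun _ =>
    evol_exceeds_le_one h0 h1 _ _ _ _ _

lemma tendsto_pathLaw_batchDelay_le {m : ℕ} (hm : 1 ≤ m) {σ : ℝ≥0} (h0 : 0 < σ) (h1 : σ < 1)
    (init : PMF (Fin N → ℕ)) (n : ℕ) :
    Tendsto (fun b => pathLaw N m σ h1.le init {ω | batchDelay m ω b ≤ (n : ℕ∞)}) atTop
      (𝓝 (ENNReal.ofReal (1 - limitTail N σ m n))) := by
  have h0' : (0 : ℝ) < σ := by exact_mod_cast h0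
  have h1' : (σ : ℝ) < 1 := by exact_mod_cast h1
  simp only [pathLaw_batchDelay_le hm σ h1.le init]
  have hc : ENNReal.ofReal (1 - limitTail N σ m n) =
      ∫⁻ _, ENNReal.ofReal (1 - limitTail N σ m n) ∂init.toMeasure := by
    rw [lintegral_const, measure_univ, mul_one]
  rw [hc]
  refine tendsto_lintegral_of_dominated_convergence (fun _ => 1)
    (fun b => Measurable.of_discrete) (fun b => ae_of_all _ fun L => ?_) (by simp)
    (ae_of_all _ fun L => ?_)
  · rw [← ENNReal.ofReal_one]
    refine ENNReal.ofReal_le_ofReal ?_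
    linarith [evol_nonneg h0'.le h1'.le m 0 (b * m + n) (exceeds_nonneg (N := N) (n / m)) L]
  · exact (ENNReal.continuous_ofReal.tendsto _).comp
      ((tendsto_evol_limitTail h0' h1' hm n L).const_sub 1)

/-- Both the slot and the threshold in `limitTail` vary with `n`; the order is inherited from the
nested events `D_b ≤ n` on path space. -/
lemma limitTail_antitone {m : ℕ} (hm : 1 ≤ m) {σ : ℝ≥0} (h0 : 0 < σ) (h1 : σ < 1) :
    Antitone (limitTail N σ m) := by
  intro n n' hn
  have hle := le_of_tendsto_of_tendsto'
    (tendsto_pathLaw_batchDelay_le (N := N) hm h0 h1 (PMF.pure 0) n)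
    (tendsto_pathLaw_batchDelay_le (N := N) hm h0 h1 (PMF.pure 0) n') fun b =>
      measure_mono fun ω (hω : batchDelay m ω b ≤ n) => hω.trans (by exact_mod_cast hn)
  rw [ENNReal.ofReal_le_ofReal_iff] at hle
  · linarith
  · linarith [limitTail_le_one (N := N) σ.coe_nonneg (by exact_mod_cast h1.le) m n']

/-- Below the critical load, the tail of the limit law decays exponentially. -/
lemma exists_limitTail_le {σ : ℝ} (h0 : 0 ≤ σ) (h1 : σ ≤ 1) {m : ℕ} (hm : 1 ≤ m)
    (h : (N : ℝ) < m * σ) :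
    ∃ C q : ℝ, 0 < q ∧ q < 1 ∧ ∀ n, limitTail N σ m n ≤ C * q ^ (n / m) := by
  obtain ⟨θ, hθ, hρ⟩ := exists_one_lt_periodFactor_lt_one h
  obtain ⟨C, hC⟩ := exists_evol_pow_total_le h0 h1 hθ.le hm hρ
  have hθ0 : 0 < θ := by linarith
  refine ⟨C, θ⁻¹, by positivity, inv_lt_one_of_one_lt₀ hθ, fun n => ?_⟩
  refine le_of_tendsto' (tendsto_evol_zero_limitTail h0 h1 m n) fun b => ?_
  calc evol σ m 0 (b * m + n) (exceeds (N := N) (n / m)) 0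
      ≤ evol σ m 0 (b * m + n) (fun x : Fin N → ℕ => θ⁻¹ ^ (n / m) * θ ^ total x) 0 := by
        refine evol_mono h0 h1 _ _ _ (fun L => ?_) 0
        unfold exceeds
        dsimp only
        split_ifs with hL
        · positivity
        · push Not at hL
          obtain ⟨i, hi⟩ := hL
          have : n / m ≤ total L :=
            hi.le.trans (Finset.single_le_sum (f := L) (fun _ _ => Nat.zero_le _)
              (Finset.mem_univ i))
          rw [inv_pow, inv_mul_eq_div, one_le_div (by positivity)]
          exact pow_le_pow_right₀ hθ.le this
    _ ≤ _ := by
        rw [evol_mul_left, mul_comm]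
        gcongr
        exact hC _

lemma isStationaryDelayLaw_iff {m : ℕ} (hm : 1 ≤ m) {σ : ℝ≥0} (h0 : 0 < σ) (h1 : σ < 1)
    (ν : Measure ℕ∞) :
    IsStationaryDelayLaw N m σ h1.le ν ↔ IsProbabilityMeasure ν ∧
      ∀ n : ℕ, ν (Set.Iic (n : ℕ∞)) = ENNReal.ofReal (1 - limitTail N σ m n) := by
  refine and_congr_right fun _ => ⟨fun h n => ?_, fun h init n => ?_⟩
  · exact tendsto_nhds_unique (h (PMF.pure 0) n) (tendsto_pathLaw_batchDelay_le hm h0 h1 _ n)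
  · rw [h n]
    exact tendsto_pathLaw_batchDelay_le hm h0 h1 init n

lemma existsUnique_isStationaryDelayLaw {m : ℕ} (hm : 1 ≤ m) {σ : ℝ≥0} (h0 : 0 < σ)
    (h1 : σ < 1) : ∃! ν : Measure ℕ∞, IsStationaryDelayLaw N m σ h1.le ν := by
  have h0' : (0 : ℝ) ≤ σ := σ.coe_nonneg
  have h1' : (σ : ℝ) ≤ 1 := by exact_mod_cast h1.le
  simp only [isStationaryDelayLaw_iff hm h0 h1]
  obtain ⟨ν, hν, hνF⟩ := exists_measure_Iic_eq (F := fun n => 1 - limitTail N σ m n)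
    (fun n n' hn => sub_le_sub_left (limitTail_antitone hm h0 h1 hn) 1)
    (fun n => sub_le_self 1 (limitTail_nonneg h0' h1' m n))
  refine ⟨ν, ⟨hν, hνF⟩, fun μ hμ => ?_⟩
  have := hμ.1
  exact measure_ext_of_Iic fun n => by rw [hμ.2, hνF]

lemma hasFiniteMean_of_lt {m : ℕ} (hm : 1 ≤ m) {σ : ℝ≥0} (h1 : σ < 1)
    (h : (N : ℝ) < m * σ) {ν : Measure ℕ∞} [IsProbabilityMeasure ν]
    (hν : ∀ n : ℕ, ν (Set.Iic (n : ℕ∞)) = ENNReal.ofReal (1 - limitTail N σ m n)) :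
    HasFiniteMean ν := by
  have h0' : (0 : ℝ) ≤ σ := σ.coe_nonneg
  have h1' : (σ : ℝ) ≤ 1 := by exact_mod_cast h1.le
  obtain ⟨C, q, hq0, hq1, hC⟩ := exists_limitTail_le h0' h1' hm h
  have hIoi : ∀ n : ℕ, ν (Set.Ioi (n : ℕ∞)) = ENNReal.ofReal (limitTail N σ m n) := by
    intro n
    rw [← Set.compl_Iic, prob_compl_eq_one_sub measurableSet_Iic, hν, ← ENNReal.ofReal_one,
      ← ENNReal.ofReal_sub _ (sub_nonneg.2 (limitTail_le_one h0' h1' m n)), sub_sub_cancel]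
  unfold HasFiniteMean
  rw [lintegral_toENNReal_eq_tsum]
  simp only [hIoi]
  refine (Summable.tsum_ofReal_lt_top ?_)
  exact Summable.of_nonneg_of_le (fun n => limitTail_nonneg h0' h1' m n) hC
    ((summable_pow_div hq0 hq1 hm).mul_left C)

lemma limitTail_eq_one {m : ℕ} (hm : 1 ≤ m) {σ : ℝ} (h0 : 0 < σ) (h1 : σ < 1)
    (h : m * σ ≤ (N : ℝ)) (n : ℕ) : limitTail N σ m n = 1 :=
  tendsto_nhds_unique (tendsto_evol_zero_limitTail h0.le h1.le m n)
    (tendsto_evol_exceeds_one h0 h1 hm h n (n / m))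

end Limit

end FJQ

theorem theorem2 (N m : ℕ) (hN : 1 ≤ N) (hm : 1 ≤ m) (r : ℝ) (hr : 1 / r = m)
    (σ : ℝ≥0) (hσ0 : 0 < σ) (hσ1 : σ < 1) :
    (∃! ν : Measure ℕ∞, FJQ.IsStationaryDelayLaw N m σ hσ1.le ν) ∧
    ∀ ν : Measure ℕ∞, FJQ.IsStationaryDelayLaw N m σ hσ1.le ν →
      ((FJQ.IsProper ν ∧ FJQ.HasFiniteMean ν) ↔ (N : ℝ) * r < (σ : ℝ)) := by
  refine ⟨FJQ.existsUnique_isStationaryDelayLaw hm hσ0 hσ1, fun ν hν => ?_⟩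
  obtain ⟨hprob, hF⟩ := (FJQ.isStationaryDelayLaw_iff hm hσ0 hσ1 ν).1 hν
  have hmR : (0 : ℝ) < m := by exact_mod_cast hm
  have hload : (N : ℝ) * r < σ ↔ (N : ℝ) < m * σ := by
    have hr' : r = (m : ℝ)⁻¹ := by rw [← hr, one_div, inv_inv]
    rw [hr', ← div_eq_mul_inv, div_lt_iff₀ hmR, mul_comm]
  rw [hload]
  refine ⟨fun h => ?_, fun h => ?_⟩
  -- At or above the critical load every tail equals `1`, so properness already fails.
  · by_contra hc
    refine FJQ.not_isProper_of_Iic_eq_zero (fun n => ?_) h.1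
    rw [hF n, FJQ.limitTail_eq_one hm (by exact_mod_cast hσ0) (by exact_mod_cast hσ1)
      (not_lt.1 hc), sub_self, ENNReal.ofReal_zero]
  · have hmean := FJQ.hasFiniteMean_of_lt hm hσ1 h hF
    exact ⟨hmean.isProper, hmean⟩
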